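/- Let $T\in(0,\infty)$ and let the following data be given: a transport velocity $V\in C^1([0,1];\mathbb{R}_{>0})$; functions $\sigma_0,\sigma_1\in C^1(\mathbb{R}\times[0,1];\mathbb{R}_{\ge 0})$; a friction coefficient $\mu\in C^1(\mathbb{R};[\mu_{\min},\infty))$ with $\mu_{\min}>0$; and a regularization $|\cdot|_\varepsilon$ ($\varepsilon\ge 0$) of the absolute value, that is, a family of continuous functions $|\cdot|_\varepsilon:\mathbb{R}\to\mathbb{R}_{\ge 0}$ with $|\cdot|_0=|\cdot|$ and $|\cdot|_\varepsilon\in C^1(\mathbb{R};\mathbb{R}_{\ge 0})$ for $\varepsilon>0$ (for example $|v|_\varepsilon=\sqrt{v^2+\varepsilon}$). Put $g(v,\xi)=\sigma_1(v,\xi)|v|_\varepsilon+\mu(v)$ and consider the distributed FrBD (Friction with Bristle Dynamics) model $$\frac{\partial z(\xi,t)}{\partial t}+V(\xi)\frac{\partial z(\xi,t)}{\partial \xi}=-\frac{\sigma_0(v(t),\xi)\,|v(t)|_\varepsilon}{g(v(t),\xi)}\,z(\xi,t)+\frac{\mu(v(t))}{g(v(t),\xi)}\,v(t),\qquad (\xi,t)\in(0,1)\times(0,T),$$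 with boundary condition $z(0,t)=0$ for $t\in(0,T)$ and initial condition $z(\xi,0)=z_0(\xi)$ for $\xi\in(0,1)$. **Theorem (existence and uniqueness of classical solutions).** Suppose that $\varepsilon>0$. Then for every input $v\in C^1([0,T];\mathbb{R})$ and every $z_0\in H^1((0,1);\mathbb{R})$ with $z_0(0)=0$ there is a unique classical solution $$z\in C^1\bigl([0,T];L^2((0,1);\mathbb{R})\bigr)\cap C^0\bigl([0,T];H^1((0,1);\mathbb{R})\bigr),$$ that is, a unique $z$ in this space that satisfies the equation in $L^2((0,1);\mathbb{R})$ (with $\partial z/\partial\xi$ the weak derivative) for every $t\in(0,T)$, the boundary condition (for the continuous representative of $z(\cdot,t)$ on $[0,1]$) for every $t\in(0,T)$, and $z(\cdot,0)=z_0$. -/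

import Mathlib

open Set MeasureTheory
open scoped ContDiff

noncomputable section

namespace FrBD

/-- Lebesgue measure on the unit interval `(0,1)`. -/
abbrev unitMeasure : Measure ℝ := volume.restrict (Ioo (0 : ℝ) 1)

/-- The Hilbert space `L²((0,1);ℝ)`. -/
abbrev L2 : Type := Lp ℝ 2 unitMeasure

/-- `φ` is a test function on `(0,1)`: smooth, with compact support contained in `(0,1)`. -/
structure IsTestFunction (φ : ℝ → ℝ) : Prop where
  smooth : ContDiff ℝ ∞ φ
  compact : HasCompactSupport φ
  support : tsupport φ ⊆ Ioo (0 : ℝ) 1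

/-- `w ∈ L²(0,1)` is the weak derivative of `u ∈ L²(0,1)`. -/
def IsWeakDeriv (u w : L2) : Prop :=
  ∀ φ : ℝ → ℝ, IsTestFunction φ →
    ∫ ξ in Ioo (0 : ℝ) 1, u ξ * deriv φ ξ = -∫ ξ in Ioo (0 : ℝ) 1, w ξ * φ ξ

/-- The product of an `L²` function with a continuous compactly supported one is integrable. -/
theorem integrable_mul_of_compact (u : L2) {ψ : ℝ → ℝ} (hψ : Continuous ψ)
    (hc : HasCompactSupport ψ) : Integrable (fun ξ => u ξ * ψ ξ) unitMeasure :=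
  MemLp.integrable_mul (p := 2) (q := 2) (Lp.memLp u) (hψ.memLp_of_hasCompactSupport hc)

theorem IsTestFunction.continuous_deriv {φ : ℝ → ℝ} (h : IsTestFunction φ) :
    Continuous (deriv φ) :=
  h.smooth.continuous_deriv (by exact_mod_cast le_top)

theorem integral_add_mul (u u' : L2) {ψ : ℝ → ℝ} (hψ : Continuous ψ) (hc : HasCompactSupport ψ) :
    ∫ ξ in Ioo (0 : ℝ) 1, (u + u' : L2) ξ * ψ ξ =
      (∫ ξ in Ioo (0 : ℝ) 1, u ξ * ψ ξ) + ∫ ξ in Ioo (0 : ℝ) 1, u' ξ * ψ ξ := by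
  rw [← integral_add (integrable_mul_of_compact u hψ hc) (integrable_mul_of_compact u' hψ hc)]
  refine integral_congr_ae ?_
  filter_upwards [Lp.coeFn_add u u'] with ξ hξ
  rw [hξ, Pi.add_apply, add_mul]

theorem integral_smul_mul (c : ℝ) (u : L2) (ψ : ℝ → ℝ) :
    ∫ ξ in Ioo (0 : ℝ) 1, (c • u : L2) ξ * ψ ξ = c * ∫ ξ in Ioo (0 : ℝ) 1, u ξ * ψ ξ := by
  rw [← integral_const_mul]
  refine integral_congr_ae ?_
  filter_upwards [Lp.coeFn_smul c u] with ξ hξ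
  rw [hξ, Pi.smul_apply, smul_eq_mul, mul_assoc]

theorem isWeakDeriv_add {u w u' w' : L2} (h : IsWeakDeriv u w) (h' : IsWeakDeriv u' w') :
    IsWeakDeriv (u + u') (w + w') := by
  intro φ hφ
  rw [integral_add_mul u u' hφ.continuous_deriv hφ.compact.deriv,
    integral_add_mul w w' hφ.smooth.continuous hφ.compact, h φ hφ, h' φ hφ, neg_add]

theorem isWeakDeriv_smul (c : ℝ) {u w : L2} (h : IsWeakDeriv u w) :
    IsWeakDeriv (c • u) (c • w) := by
  intro φ hφ
  rw [integral_smul_mul, integral_smul_mul, h φ hφ, mul_neg]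

/-- The Sobolev space `H¹((0,1);ℝ)` as a submodule, realised as the space of pairs `(u, ∂u/∂ξ)` of an
`L²` function and its weak derivative in `L²`. As a subspace of the `ℓ²`-product it carries the norm
`‖u‖²_{H¹} = ‖u‖²_{L²} + ‖∂u/∂ξ‖²_{L²}`. -/
def H1Submodule : Submodule ℝ (WithLp 2 (L2 × L2)) where
  carrier := {p | IsWeakDeriv p.fst p.snd}
  add_mem' := fun hp hq => isWeakDeriv_add hp hq
  zero_mem' := by
    have h : IsWeakDeriv ((0 : ℝ) • (0 : L2)) ((0 : ℝ) • (0 : L2)) := by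
      intro φ _
      rw [integral_smul_mul, integral_smul_mul, zero_mul, zero_mul, neg_zero]
    rw [smul_zero] at h
    exact h
  smul_mem' := fun c _ hp => isWeakDeriv_smul c hp

/-- The Sobolev space `H¹((0,1);ℝ)`, with its norm. -/
abbrev H1 : Type := ↥H1Submodule

/-- The `L²` class of an `H¹` function. -/
def H1.toL2 (u : H1) : L2 := u.1.fst

/-- The weak derivative `∂u/∂ξ ∈ L²` of an `H¹` function. -/
def H1.weakDeriv (u : H1) : L2 := u.1.snd

/-- `u(0) = 0`: the continuous representative of `u` on `[0,1]` vanishes at `0`. -/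
def H1.VanishesAtZero (u : H1) : Prop :=
  ∃ f : ℝ → ℝ, ContinuousOn f (Icc 0 1) ∧ (∀ᵐ ξ ∂unitMeasure, u.toL2 ξ = f ξ) ∧ f 0 = 0

/-- `absReg ε` is a regularization `|·|_ε` of the absolute value, for `ε ≥ 0`:
continuous and nonnegative, equal to `|·|` for `ε = 0`, and `C¹` as soon as `ε > 0`. -/
structure IsAbsRegularization (absReg : ℝ → ℝ → ℝ) : Prop where
  nonneg : ∀ ε, 0 ≤ ε → ∀ x, 0 ≤ absReg ε x
  continuous : ∀ ε, 0 ≤ ε → Continuous (absReg ε)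
  zero_eq : ∀ x, absReg 0 x = |x|
  contDiff : ∀ ε, 0 < ε → ContDiff ℝ 1 (absReg ε)

/-- `g(v,ξ) = σ₁(v,ξ) |v|_ε + μ(v)`; here `absE` stands for `|·|_ε`. -/
def g (absE : ℝ → ℝ) (σ₁ : ℝ → ℝ → ℝ) (μ : ℝ → ℝ) (v ξ : ℝ) : ℝ :=
  σ₁ v ξ * absE v + μ v

/-- `z : [0,T] → H¹(0,1)` is a classical solution of the distributed FrBD model
`∂z/∂t + V(ξ) ∂z/∂ξ = - σ₀(v(t),ξ) |v(t)|_ε / g(v(t),ξ) z + μ(v(t)) / g(v(t),ξ) v(t)`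
on `(0,1) × (0,T)` with `z(0,t) = 0` and `z(ξ,0) = z₀(ξ)`, i.e.
`z ∈ C¹([0,T];L²) ∩ C⁰([0,T];H¹)` and the equation holds in `L²(0,1)` for all `t ∈ (0,T)`.
Here `absE` stands for `|·|_ε`, and only the values of `z` on `[0,T]` matter. -/
structure IsClassicalSolution (absE : ℝ → ℝ) (V : ℝ → ℝ) (σ₀ σ₁ : ℝ → ℝ → ℝ) (μ : ℝ → ℝ)
    (T : ℝ) (v : ℝ → ℝ) (z₀ : H1) (z : ℝ → H1) : Prop where
  contDiffOn_L2 : ContDiffOn ℝ 1 (fun t => (z t).toL2) (Icc 0 T)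
  continuousOn_H1 : ContinuousOn z (Icc 0 T)
  pde : ∀ t ∈ Ioo 0 T, ∀ᵐ ξ ∂unitMeasure,
    (deriv (fun s => (z s).toL2) t) ξ + V ξ * (z t).weakDeriv ξ =
      -(σ₀ (v t) ξ * absE (v t) / g absE σ₁ μ (v t) ξ) * (z t).toL2 ξ
        + μ (v t) / g absE σ₁ μ (v t) ξ * v t
  boundary : ∀ t ∈ Ioo 0 T, (z t).VanishesAtZero
  initial : z 0 = z₀

end FrBD

end

/-!
The equation is a transport equation with positive velocity `V` and damping, and its solution can be
written down by the method of characteristics.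

Let `τ(ξ) = ∫₀^ξ 1/V` be the travel time. For a source `k(ξ,t)` that is continuous and has a
continuous time derivative, `charIntegral` is the integral of `k` along the characteristics, started
at the boundary `ξ = 0`. It is continuously differentiable and vanishes at `ξ = 0`, and `∂/∂t + V ∂/∂ξ`
maps it to `k` (`isC1SpaceTime_charIntegral`); `k` need not be differentiable in `ξ`, since `ξ` is the
integration variable. For this reason the coefficients may simply be frozen outside of `[0,1]`.
Starting at the boundary rather than at time `0` requires the coefficients at all times, so the input
`v` is first extended to a `C¹` function on the line (`exists_C1_extension`).

For the damping `α` and the source `β`, let `A` be the characteristic integral of `α` and `P` that of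
`β exp A`. Then `z = exp(-A) (P + G(τ(ξ) - t))` formally solves the equation for every function `G`.
The initial condition fixes `G` on `[0,τ(1)]`, where it is the primitive of some `γ ∈ L²`, and the
boundary condition is met by `γ = 0` on the negative half-line (`exists_profile`). Both formal
derivatives of `z` are the sum of a jointly continuous function and a jointly continuous multiple of
`γ(τ(ξ) - t)`, hence are continuous in time with values in `L²`, because translations are continuous
in `L²(ℝ)` and `τ` is bi-Lipschitz (`exists_continuous_translate`, `exists_continuous_affine`). That
they are the weak derivative in `ξ` and the derivative of the `L²`-valued curve follows from the
product rule for absolutely continuous functions in the respective variable, combined with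
integration by parts (`HasACDeriv.isWeakDeriv`) and with Fubini's theorem
(`hasDerivAt_of_ae_integral`).

For uniqueness, the difference `u` of two solutions has zero data, and its weighted energy `∫₀¹ u²/V`
has the derivative `-2 ∫₀¹ u ∂u/∂ξ - 2 ∫₀¹ α u²/V`. The first integral is `u(1)²/2`, and `α ≥ 0`, so
that the energy does not increase (`toL2_eq_zero_of_transport`). Here and for the initial datum one
needs that an `H¹` function is the primitive of its weak derivative, which rests on the lemma of
du Bois-Reymond (`ae_eq_const_of_integral_mul_deriv`).
-/

namespace FrBD

open Filter Topology
open scoped NNReal ENNReal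

/-! ### Absolutely continuous functions and the Sobolev space on the unit interval -/

/-- `f` is absolutely continuous between `a` and `b`, with almost everywhere derivative `w`. -/
structure HasACDeriv (f w : ℝ → ℝ) (a b : ℝ) : Prop where
  ac : AbsolutelyContinuousOnInterval f a b
  ae_deriv : ∀ᵐ x, x ∈ uIcc a b → HasDerivAt f (w x) x

namespace HasACDeriv

variable {f g w q : ℝ → ℝ} {a b : ℝ}

theorem add (hf : HasACDeriv f w a b) (hg : HasACDeriv g q a b) :
    HasACDeriv (fun x => f x + g x) (fun x => w x + q x) a b := by
  refine ⟨hf.ac.add hg.ac, ?_⟩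
  filter_upwards [hf.ae_deriv, hg.ae_deriv] with x h₁ h₂ hx using (h₁ hx).add (h₂ hx)

theorem sub (hf : HasACDeriv f w a b) (hg : HasACDeriv g q a b) :
    HasACDeriv (fun x => f x - g x) (fun x => w x - q x) a b := by
  refine ⟨hf.ac.sub hg.ac, ?_⟩
  filter_upwards [hf.ae_deriv, hg.ae_deriv] with x h₁ h₂ hx using (h₁ hx).sub (h₂ hx)

theorem mul (hf : HasACDeriv f w a b) (hg : HasACDeriv g q a b) :
    HasACDeriv (fun x => f x * g x) (fun x => w x * g x + f x * q x) a b := by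
  refine ⟨hf.ac.mul hg.ac, ?_⟩
  filter_upwards [hf.ae_deriv, hg.ae_deriv] with x h₁ h₂ hx using (h₁ hx).mul (h₂ hx)

theorem of_hasDerivAt (hf : ∀ x, HasDerivAt f (w x) x) (hw : Continuous w) :
    HasACDeriv f w a b := by
  have hd : deriv f = w := funext fun x => (hf x).deriv
  have : ContDiff ℝ 1 f := contDiff_one_iff_deriv.2
    ⟨fun x => (hf x).differentiableAt, hd ▸ hw⟩
  exact ⟨this.contDiffOn.absolutelyContinuousOnInterval, Eventually.of_forall fun x _ => hf x⟩

theorem primitive (hw : LocallyIntegrable w volume) (c C : ℝ) :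
    HasACDeriv (fun x => C + ∫ y in c..x, w y) w a b := by
  have hi : ∀ x y, IntervalIntegrable w volume x y := fun x y =>
    intervalIntegrable_iff.2 ((hw.integrableOn_isCompact isCompact_uIcc).mono_set uIoc_subset_uIcc)
  constructor
  · have h := ((hi a b).absolutelyContinuousOnInterval_intervalIntegral (left_mem_uIcc))
    have h' : AbsolutelyContinuousOnInterval (fun _ : ℝ => C + ∫ y in c..a, w y) a b :=
      (contDiff_const (n := 1) (𝕜 := ℝ)).contDiffOn.absolutelyContinuousOnInterval
    have e : (fun x => C + ∫ y in c..x, w y) =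
        (fun _ => C + ∫ y in c..a, w y) + fun x => ∫ y in a..x, w y := by
      funext x
      rw [Pi.add_apply, add_assoc,
        intervalIntegral.integral_add_adjacent_intervals (hi _ _) (hi _ _)]
    exact e ▸ h'.add h
  · filter_upwards [_root_.LocallyIntegrable.ae_hasDerivAt_integral hw] with x hx _
    exact (hx c).const_add C

theorem integral_eq (hf : HasACDeriv f w a b) : ∫ x in a..b, w x = f b - f a := by
  rw [← hf.ac.integral_deriv_eq_sub]
  refine intervalIntegral.integral_congr_ae ?_
  filter_upwards [hf.ae_deriv] with x hx hx' using (hx (uIoc_subset_uIcc hx')).deriv.symm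

theorem mono {c d : ℝ} (hf : HasACDeriv f w a b) (h : uIcc c d ⊆ uIcc a b) :
    HasACDeriv f w c d :=
  ⟨hf.ac.mono h, by filter_upwards [hf.ae_deriv] with x hx hx' using hx (h hx')⟩

theorem congr (hf : HasACDeriv f w a b) (h : ∀ x, g x = f x) : HasACDeriv g w a b :=
  (funext h : g = f) ▸ hf

end HasACDeriv

theorem ae_unitMeasure_iff {p : ℝ → Prop} :
    (∀ᵐ ξ ∂unitMeasure, p ξ) ↔ ∀ᵐ ξ, ξ ∈ Ioo (0 : ℝ) 1 → p ξ :=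
  ae_restrict_iff' measurableSet_Ioo

theorem integral_unit_eq (f : ℝ → ℝ) : ∫ ξ in Ioo (0 : ℝ) 1, f ξ = ∫ ξ in (0 : ℝ)..1, f ξ := by
  rw [intervalIntegral.integral_of_le zero_le_one, integral_Ioc_eq_integral_Ioo]

/-- Integration by parts: the almost everywhere derivative of an absolutely continuous function is
its weak derivative. -/
theorem HasACDeriv.isWeakDeriv {f w : ℝ → ℝ} (hf : HasACDeriv f w 0 1) {u p : L2}
    (hu : ∀ᵐ ξ ∂unitMeasure, u ξ = f ξ) (hp : ∀ᵐ ξ ∂unitMeasure, p ξ = w ξ) :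
    IsWeakDeriv u p := by
  intro φ hφ
  have hφ0 : ∀ x, x ∉ Ioo (0 : ℝ) 1 → φ x = 0 := fun x hx =>
    image_eq_zero_of_notMem_tsupport fun h => hx (hφ.support h)
  have hφd : HasACDeriv φ (deriv φ) 0 1 :=
    .of_hasDerivAt (fun x => (hφ.smooth.differentiable (by simp) x).hasDerivAt)
      hφ.continuous_deriv
  have h := (hf.mul hφd).integral_eq
  rw [hφ0 0 (by simp), hφ0 1 (by simp), ← integral_unit_eq, integral_add] at h
  · have e₁ : ∫ ξ in Ioo (0 : ℝ) 1, u ξ * deriv φ ξ = ∫ ξ in Ioo (0 : ℝ) 1, f ξ * deriv φ ξ :=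
      integral_congr_ae (by filter_upwards [hu] with ξ hξ using by simp only [hξ])
    have e₂ : ∫ ξ in Ioo (0 : ℝ) 1, p ξ * φ ξ = ∫ ξ in Ioo (0 : ℝ) 1, w ξ * φ ξ :=
      integral_congr_ae (by filter_upwards [hp] with ξ hξ using by simp only [hξ])
    rw [e₁, e₂]
    linarith
  · refine (integrable_mul_of_compact p hφ.smooth.continuous hφ.compact).congr ?_
    filter_upwards [hp] with ξ hξ using by simp only [hξ]
  · refine (integrable_mul_of_compact u hφ.continuous_deriv hφ.compact.deriv).congr ?_
    filter_upwards [hu] with ξ hξ using by simp only [hξ]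

/-- The fundamental lemma of the calculus of variations on `(0,1)`. -/
theorem ae_eq_zero_of_integral_mul_test {f : ℝ → ℝ} (hf : Integrable f unitMeasure)
    (h : ∀ φ, IsTestFunction φ → ∫ ξ in Ioo (0 : ℝ) 1, f ξ * φ ξ = 0) :
    ∀ᵐ ξ ∂unitMeasure, f ξ = 0 := by
  rw [ae_unitMeasure_iff]
  refine isOpen_Ioo.ae_eq_zero_of_integral_contDiff_smul_eq_zero
    (IntegrableOn.locallyIntegrableOn hf) fun φ h₁ h₂ h₃ => ?_
  rw [← h φ ⟨h₁, h₂, h₃⟩, ← integral_indicator measurableSet_Ioo]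
  congr 1
  funext x
  by_cases hx : x ∈ Ioo (0 : ℝ) 1
  · rw [indicator_of_mem hx, smul_eq_mul, mul_comm]
  · rw [indicator_of_notMem hx, image_eq_zero_of_notMem_tsupport fun h => hx (h₃ h), zero_smul]

theorem integrable_L2 (u : L2) : Integrable u unitMeasure :=
  (Lp.memLp u).integrable (by norm_num)

theorem IsWeakDeriv.unique {u w w' : L2} (h : IsWeakDeriv u w) (h' : IsWeakDeriv u w') :
    w = w' := by
  refine Lp.ext ?_
  have := ae_eq_zero_of_integral_mul_test (f := fun ξ => w ξ - w' ξ)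
    ((integrable_L2 w).sub (integrable_L2 w')) fun φ hφ => ?_
  · filter_upwards [this] with ξ hξ using sub_eq_zero.1 hξ
  · have h₁ := h φ hφ
    have h₂ := h' φ hφ
    simp only [sub_mul]
    rw [integral_sub (integrable_mul_of_compact w hφ.smooth.continuous hφ.compact)
      (integrable_mul_of_compact w' hφ.smooth.continuous hφ.compact)]
    linarith

theorem H1.ext_toL2 {u u' : H1} (h : u.toL2 = u'.toL2) : u = u' := by
  have h₂ : u.weakDeriv = u'.weakDeriv := IsWeakDeriv.unique (u := u.toL2) u.2 (h ▸ u'.2)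
  apply Subtype.ext
  apply (WithLp.equiv 2 (L2 × L2)).injective
  exact Prod.ext h h₂

/-- The primitive of a test function with zero mean is a test function. -/
theorem IsTestFunction.exists_primitive {ψ : ℝ → ℝ} (hψ : IsTestFunction ψ)
    (h0 : ∫ ξ in (0 : ℝ)..1, ψ ξ = 0) : ∃ φ, IsTestFunction φ ∧ deriv φ = ψ := by
  have hc : Continuous ψ := hψ.smooth.continuous
  set φ : ℝ → ℝ := fun x => ∫ y in (0 : ℝ)..x, ψ y with hφ
  have hd : ∀ x, HasDerivAt φ (ψ x) x := fun x => hc.integral_hasStrictDerivAt 0 x |>.hasDerivAt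
  have hderiv : deriv φ = ψ := funext fun x => (hd x).deriv
  -- a compact interval `[a, b] ⊆ (0, 1)` outside of which `ψ` vanishes
  obtain ⟨a, b, ha, hb, hab⟩ : ∃ a b, 0 < a ∧ b < 1 ∧ tsupport ψ ⊆ Icc a b := by
    by_cases hne : (tsupport ψ).Nonempty
    · obtain ⟨a, haS, ha⟩ := hψ.compact.isCompact.exists_isLeast hne
      obtain ⟨b, hbS, hb⟩ := hψ.compact.isCompact.exists_isGreatest hne
      exact ⟨a, b, (hψ.support haS).1, (hψ.support hbS).2, fun x hx => ⟨ha hx, hb hx⟩⟩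
    · exact ⟨1, 0, one_pos, one_pos, by simp [not_nonempty_iff_eq_empty.1 hne]⟩
  have hz : ∀ x, x ∉ Icc a b → ψ x = 0 := fun x hx =>
    image_eq_zero_of_notMem_tsupport fun h => hx (hab h)
  have hl : ∀ x, x < a → φ x = 0 := fun x hx => by
    rw [hφ]
    refine (intervalIntegral.integral_congr (g := fun _ => 0) fun y hy => hz y fun h => ?_).trans
      (by simp)
    rcases le_total 0 x with hx0 | hx0
    · rw [uIcc_of_le hx0] at hy; linarith [hy.2, h.1]
    · rw [uIcc_of_ge hx0] at hy; linarith [hy.2, h.1]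
  have hr : ∀ x, b < x → φ x = 0 := fun x hx => by
    have : φ x = (∫ y in (0 : ℝ)..1, ψ y) + ∫ y in (1 : ℝ)..x, ψ y :=
      (intervalIntegral.integral_add_adjacent_intervals (hc.intervalIntegrable _ _)
        (hc.intervalIntegrable _ _)).symm
    rw [this, h0, zero_add]
    refine (intervalIntegral.integral_congr (g := fun _ => 0) fun y hy => hz y fun h => ?_).trans
      (by simp)
    rcases le_total 1 x with hx0 | hx0
    · rw [uIcc_of_le hx0] at hy; linarith [hy.1, h.2]
    · rw [uIcc_of_ge hx0] at hy; linarith [hy.1, h.2]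
  have hs : Function.support φ ⊆ Icc a b := fun x hx => by
    by_contra h
    rw [mem_Icc, not_and_or, not_le, not_le] at h
    exact hx (h.elim (hl x) (hr x))
  have hts : tsupport φ ⊆ Icc a b := closure_minimal hs isClosed_Icc
  refine ⟨φ, ⟨?_, HasCompactSupport.of_support_subset_isCompact isCompact_Icc hs,
    hts.trans fun x hx => ⟨ha.trans_le hx.1, hx.2.trans_lt hb⟩⟩, hderiv⟩
  exact contDiff_infty_iff_deriv.2 ⟨fun x => (hd x).differentiableAt, hderiv ▸ hψ.smooth⟩

theorem exists_test_integral_one :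
    ∃ ρ, IsTestFunction ρ ∧ ∫ ξ in (0 : ℝ)..1, ρ ξ = 1 := by
  let b : ContDiffBump (1 / 2 : ℝ) := ⟨1 / 8, 1 / 4, by norm_num, by norm_num⟩
  have hts : tsupport (b.normed volume) ⊆ Ioo (0 : ℝ) 1 := by
    rw [b.tsupport_normed_eq, Real.closedBall_eq_Icc]
    intro x hx
    have h1 := hx.1
    have h2 := hx.2
    simp only [b] at h1 h2
    constructor <;> norm_num at h1 h2 <;> linarith
  refine ⟨b.normed volume, ⟨b.contDiff_normed, b.hasCompactSupport_normed, hts⟩, ?_⟩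
  rw [← integral_unit_eq]
  refine Eq.trans ?_ (b.integral_normed (μ := volume))
  refine setIntegral_eq_integral_of_forall_compl_eq_zero fun x hx => ?_
  exact image_eq_zero_of_notMem_tsupport fun h => hx (hts h)

theorem integrable_mul_of_hasCompactSupport {f φ : ℝ → ℝ} (hf : Integrable f unitMeasure)
    (hφ : Continuous φ) (hc : HasCompactSupport φ) :
    Integrable (fun ξ => f ξ * φ ξ) unitMeasure := by
  obtain ⟨C, hC⟩ := hc.exists_bound_of_continuous hφ
  exact hf.mul_bdd hφ.aestronglyMeasurable (Eventually.of_forall hC)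

/-- The lemma of du Bois-Reymond: an integrable function with zero weak derivative is constant. -/
theorem ae_eq_const_of_integral_mul_deriv {f : ℝ → ℝ} (hf : Integrable f unitMeasure)
    (h : ∀ φ, IsTestFunction φ → ∫ ξ in Ioo (0 : ℝ) 1, f ξ * deriv φ ξ = 0) :
    ∃ c, ∀ᵐ ξ ∂unitMeasure, f ξ = c := by
  obtain ⟨ρ, hρ, hρ1⟩ := exists_test_integral_one
  refine ⟨∫ ξ in Ioo (0 : ℝ) 1, f ξ * ρ ξ, ?_⟩
  set c := ∫ ξ in Ioo (0 : ℝ) 1, f ξ * ρ ξ with hc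
  have key := ae_eq_zero_of_integral_mul_test (f := fun ξ => f ξ - c)
    (hf.sub (integrable_const c)) fun ψ hψ => ?_
  · filter_upwards [key] with ξ hξ using sub_eq_zero.1 hξ
  · set m := ∫ ξ in (0 : ℝ)..1, ψ ξ with hm
    -- `ψ - m ρ` has zero mean, hence is the derivative of a test function
    have hψρ : IsTestFunction (fun x => ψ x - m * ρ x) := by
      refine ⟨hψ.smooth.sub (contDiff_const.mul hρ.smooth),
        hψ.compact.sub hρ.compact.mul_left, ?_⟩
      refine (tsupport_sub _ _).trans (union_subset hψ.support ?_)
      exact (tsupport_mul_subset_right).trans hρ.support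
    have h0 : ∫ ξ in (0 : ℝ)..1, (ψ ξ - m * ρ ξ) = 0 := by
      rw [intervalIntegral.integral_sub (hψ.smooth.continuous.intervalIntegrable _ _)
        ((hρ.smooth.continuous.const_mul m).intervalIntegrable _ _),
        intervalIntegral.integral_const_mul, hρ1, mul_one, sub_self]
    obtain ⟨φ, hφ, hφd⟩ := hψρ.exists_primitive h0
    have e := h φ hφ
    have i₁ := integrable_mul_of_hasCompactSupport hf hψ.smooth.continuous hψ.compact
    have i₂ := integrable_mul_of_hasCompactSupport hf hρ.smooth.continuous hρ.compact
    have e₂ : ∫ ξ in Ioo (0 : ℝ) 1, (f ξ * ψ ξ - m * (f ξ * ρ ξ)) = 0 := by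
      refine Eq.trans (integral_congr_ae (Eventually.of_forall fun x => ?_)) e
      simp only [hφd]
      ring
    rw [integral_sub i₁ (i₂.const_mul m), integral_const_mul, ← hc] at e₂
    simp only [sub_mul]
    rw [integral_sub i₁ ((hψ.smooth.continuous.integrable_of_hasCompactSupport
      hψ.compact).restrict.const_mul c), integral_const_mul, integral_unit_eq ψ, ← hm]
    linarith

theorem eqOn_Icc_of_ae_eq {f g : ℝ → ℝ} (hf : ContinuousOn f (Icc 0 1))
    (hg : ContinuousOn g (Icc 0 1)) (h : ∀ᵐ ξ ∂unitMeasure, f ξ = g ξ) :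
    EqOn f g (Icc 0 1) := by
  have h1 : EqOn f g (Ioo 0 1) := Measure.eqOn_open_of_ae_eq h isOpen_Ioo
    (hf.mono Ioo_subset_Icc_self) (hg.mono Ioo_subset_Icc_self)
  have := h1.of_subset_closure hf hg Ioo_subset_Icc_self
    (by rw [closure_Ioo (zero_ne_one' ℝ)])
  exact this

/-- The weak derivative of `u`, extended by zero outside of `(0,1)`. -/
noncomputable def H1.derivExt (u : H1) : ℝ → ℝ := (Ioo (0 : ℝ) 1).indicator u.weakDeriv

theorem H1.integrable_derivExt (u : H1) : Integrable u.derivExt volume :=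
  (integrable_indicator_iff measurableSet_Ioo).2 (integrable_L2 u.weakDeriv)

theorem H1.ae_derivExt_eq (u : H1) : ∀ᵐ ξ ∂unitMeasure, u.weakDeriv ξ = u.derivExt ξ := by
  rw [ae_unitMeasure_iff]
  exact Eventually.of_forall fun ξ hξ => (indicator_of_mem hξ _).symm

theorem H1.hasACDeriv_primitive (u : H1) (a b : ℝ) :
    HasACDeriv (fun ξ => ∫ y in (0 : ℝ)..ξ, u.derivExt y) u.derivExt a b := by
  simpa using HasACDeriv.primitive (a := a) (b := b) u.integrable_derivExt.locallyIntegrable 0 0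

theorem H1.continuous_primitive (u : H1) :
    Continuous (fun ξ => ∫ y in (0 : ℝ)..ξ, u.derivExt y) :=
  u.integrable_derivExt.continuous_primitive 0

theorem H1.exists_ae_eq_primitive (u : H1) :
    ∃ c, ∀ᵐ ξ ∂unitMeasure, u.toL2 ξ = c + ∫ y in (0 : ℝ)..ξ, u.derivExt y := by
  set F := fun ξ => ∫ y in (0 : ℝ)..ξ, u.derivExt y with hF
  have hFc : Continuous F := u.continuous_primitive
  have hFm : MemLp F 2 unitMeasure := by
    obtain ⟨C, hC⟩ := isCompact_Icc.exists_bound_of_continuousOn (s := Icc (0 : ℝ) 1)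
      hFc.continuousOn
    refine MemLp.of_bound hFc.aestronglyMeasurable C ?_
    rw [ae_unitMeasure_iff]
    exact Eventually.of_forall fun x hx => hC x (Ioo_subset_Icc_self hx)
  have hw : IsWeakDeriv (hFm.toLp F) u.weakDeriv :=
    (u.hasACDeriv_primitive 0 1).isWeakDeriv hFm.coeFn_toLp u.ae_derivExt_eq
  obtain ⟨c, hc⟩ := ae_eq_const_of_integral_mul_deriv (f := fun ξ => u.toL2 ξ - hFm.toLp F ξ)
    ((integrable_L2 _).sub (integrable_L2 _)) fun φ hφ => by
      have h₁ : ∫ ξ in Ioo (0 : ℝ) 1, u.toL2 ξ * deriv φ ξ = _ := u.2 φ hφ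
      have h₂ := hw φ hφ
      simp only [sub_mul]
      rw [integral_sub (integrable_mul_of_compact _ hφ.continuous_deriv hφ.compact.deriv)
        (integrable_mul_of_compact _ hφ.continuous_deriv hφ.compact.deriv), h₁, h₂]
      exact sub_self _
  refine ⟨c, ?_⟩
  filter_upwards [hc, hFm.coeFn_toLp] with ξ h₁ h₂
  rw [h₂] at h₁
  linarith

theorem H1.VanishesAtZero.ae_eq_primitive {u : H1} (hu : u.VanishesAtZero) :
    ∀ᵐ ξ ∂unitMeasure, u.toL2 ξ = ∫ y in (0 : ℝ)..ξ, u.derivExt y := by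
  obtain ⟨c, hc⟩ := u.exists_ae_eq_primitive
  obtain ⟨f, hf, hfu, hf0⟩ := hu
  have := eqOn_Icc_of_ae_eq hf
    (g := fun ξ => c + ∫ y in (0 : ℝ)..ξ, u.derivExt y)
    (continuous_const.add u.continuous_primitive).continuousOn (by
      filter_upwards [hc, hfu] with ξ h₁ h₂
      rw [← h₁, h₂])
  have h0 := this (left_mem_Icc.2 zero_le_one)
  simp only [hf0, intervalIntegral.integral_same, add_zero] at h0
  simpa [← h0] using hc

/-! ### Curves in the space of square integrable functions -/

section Antilipschitz

variable {φ : ℝ → ℝ} {K : ℝ≥0}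

/-- An antilipschitz map of the line does not compress Lebesgue measure by more than a constant. -/
theorem map_volume_le_of_antilipschitz (hφ : AntilipschitzWith K φ) (hm : Measurable φ) :
    Measure.map φ volume ≤ (K : ℝ≥0∞) • (volume : Measure ℝ) := by
  refine Measure.le_iff.2 fun s hs => ?_
  rw [Measure.map_apply hm hs, Measure.smul_apply, smul_eq_mul, ← hausdorffMeasure_real]
  simpa using hφ.hausdorffMeasure_preimage_le zero_le_one s

theorem quasiMeasurePreserving_of_antilipschitz (hφ : AntilipschitzWith K φ) (hm : Measurable φ) :
    Measure.QuasiMeasurePreserving φ volume volume :=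
  ⟨hm, Measure.absolutelyContinuous_of_le_smul (map_volume_le_of_antilipschitz hφ hm)⟩

theorem memLp_comp_antilipschitz (hφ : AntilipschitzWith K φ) (hm : Measurable φ) {f : ℝ → ℝ}
    {p : ℝ≥0∞} (hf : MemLp f p volume) : MemLp (f ∘ φ) p volume :=
  (hf.of_measure_le_smul ENNReal.coe_ne_top
    (map_volume_le_of_antilipschitz hφ hm)).comp_of_map hm.aemeasurable

theorem eLpNorm_comp_antilipschitz_le (hφ : AntilipschitzWith K φ) (hm : Measurable φ) {f : ℝ → ℝ}
    (hf : AEStronglyMeasurable f volume) :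
    eLpNorm (f ∘ φ) 2 volume ≤ (K : ℝ≥0∞) ^ (1 / 2 : ℝ) * eLpNorm f 2 volume := by
  rw [← eLpNorm_map_measure (hf.mono_ac
    (quasiMeasurePreserving_of_antilipschitz hφ hm).absolutelyContinuous) hm.aemeasurable]
  refine (eLpNorm_le_of_measure_le_smul (map_volume_le_of_antilipschitz hφ hm)).trans_eq ?_
  simp

end Antilipschitz

/-- Translation is continuous in `L²`, also when seen through a change of variables `φ`. -/
theorem exists_continuous_translate {φ : ℝ → ℝ} {K : ℝ≥0} (hφ : AntilipschitzWith K φ)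
    (hm : Measurable φ) {γ : ℝ → ℝ} (hγ : MemLp γ 2 volume) :
    ∃ Γ : ℝ → L2, Continuous Γ ∧ ∀ t, ∀ᵐ ξ ∂unitMeasure, Γ t ξ = γ (φ ξ - t) := by
  have hq := quasiMeasurePreserving_of_antilipschitz hφ hm
  have hmem : ∀ f : Lp ℝ 2 (volume : Measure ℝ), MemLp (f ∘ φ) 2 unitMeasure := fun f =>
    (memLp_comp_antilipschitz hφ hm (Lp.memLp f)).restrict _
  let C : Lp ℝ 2 (volume : Measure ℝ) → L2 := fun f => (hmem f).toLp
  have hC : Continuous C := by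
    have hL : LipschitzWith (K ^ (1 / 2 : ℝ)) C := fun f g => by
      rw [Lp.edist_toLp_toLp, Lp.edist_def]
      have h := eLpNorm_comp_antilipschitz_le hφ hm
        (f := ⇑f - ⇑g) ((Lp.aestronglyMeasurable f).sub (Lp.aestronglyMeasurable g))
      refine (eLpNorm_mono_measure _ Measure.restrict_le_self).trans (h.trans_eq ?_)
      rw [ENNReal.coe_rpow_of_nonneg _ (by norm_num)]
    exact hL.continuous
  let sh : ℝ → C(ℝ, ℝ) := fun t => ⟨fun x => x - t, by fun_prop⟩
  have hsh : Continuous sh :=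
    ContinuousMap.continuous_of_continuous_uncurry _
      (show Continuous fun p : ℝ × ℝ => p.2 - p.1 by fun_prop)
  have hmp : ∀ t, MeasurePreserving (sh t) volume volume := fun t =>
    measurePreserving_sub_right volume t
  refine ⟨fun t => C (Lp.compMeasurePreserving (sh t) (hmp t) hγ.toLp),
    hC.comp (continuous_const.compMeasurePreservingLp hsh hmp (by simp)), fun t => ?_⟩
  have h₁ : ∀ᵐ x : ℝ, Lp.compMeasurePreserving (sh t) (hmp t) (hγ.toLp) x = γ (x - t) := by
    have e := (hmp t).quasiMeasurePreserving.ae hγ.coeFn_toLp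
    filter_upwards [Lp.coeFn_compMeasurePreserving hγ.toLp (hmp t), e] with x hx hx'
    rw [hx]
    exact hx'
  filter_upwards [(hmem (Lp.compMeasurePreserving (sh t) (hmp t) hγ.toLp)).coeFn_toLp,
    ae_restrict_of_ae (hq.ae h₁)] with ξ h₂ h₃
  exact h₂.trans h₃

/-- A jointly continuous function `k(ξ,t)` as a curve of bounded functions of `ξ`, frozen outside
of `[0,1]`. -/
theorem exists_continuous_boundedCurve {k : ℝ → ℝ → ℝ}
    (hk : Continuous (fun p : ℝ × ℝ => k p.1 p.2)) :
    ∃ κ : ℝ → BoundedContinuousFunction ℝ ℝ, Continuous κ ∧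
      ∀ t, ∀ ξ ∈ Icc (0 : ℝ) 1, κ t ξ = k ξ t := by
  let c : C(ℝ, C(Icc (0 : ℝ) 1, ℝ)) := ContinuousMap.curry
    ⟨fun p : ℝ × Icc (0 : ℝ) 1 => k p.2 p.1,
      hk.comp (Continuous.prodMk (continuous_subtype_val.comp continuous_snd) continuous_fst)⟩
  let pr : C(ℝ, Icc (0 : ℝ) 1) := ⟨projIcc 0 1 zero_le_one, continuous_projIcc⟩
  refine ⟨fun t => (BoundedContinuousFunction.mkOfCompact (c t)).compContinuous pr, ?_, ?_⟩
  · exact (BoundedContinuousFunction.continuous_compContinuous pr).comp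
      ((ContinuousMap.isometryEquivBoundedOfCompact (Icc (0 : ℝ) 1) ℝ).continuous.comp c.continuous)
  · intro t ξ hξ
    change k (projIcc 0 1 zero_le_one ξ) t = k ξ t
    rw [projIcc_of_mem _ hξ]

theorem ae_mem_unit : ∀ᵐ ξ ∂unitMeasure, ξ ∈ Ioo (0 : ℝ) 1 := ae_restrict_mem measurableSet_Ioo

/-- Jointly continuous multiples of a continuous curve in `L²`, plus jointly continuous functions,
again form a continuous curve in `L²`. -/
theorem exists_continuous_affine {k l : ℝ → ℝ → ℝ} (hk : Continuous (fun p : ℝ × ℝ => k p.1 p.2))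
    (hl : Continuous (fun p : ℝ × ℝ => l p.1 p.2)) {Γ : ℝ → L2} (hΓ : Continuous Γ) :
    ∃ Z : ℝ → L2, Continuous Z ∧
      ∀ t, ∀ᵐ ξ ∂unitMeasure, Z t ξ = k ξ t + l ξ t * Γ t ξ := by
  obtain ⟨κ, hκ, hκk⟩ := exists_continuous_boundedCurve hk
  obtain ⟨ν, hν, hνl⟩ := exists_continuous_boundedCurve hl
  let B := (ContinuousLinearMap.mul ℝ ℝ).holderL unitMeasure ∞ 2 2
  let b := BoundedContinuousFunction.toLp (E := ℝ) ∞ unitMeasure ℝ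
  let a := BoundedContinuousFunction.toLp (E := ℝ) 2 unitMeasure ℝ
  refine ⟨fun t => a (κ t) + B (b (ν t)) (Γ t), ?_, fun t => ?_⟩
  · exact (a.continuous.comp hκ).add ((B.continuous.comp (b.continuous.comp hν)).clm_apply hΓ)
  · filter_upwards [Lp.coeFn_add (a (κ t)) (B (b (ν t)) (Γ t)),
      BoundedContinuousFunction.coeFn_toLp (p := 2) (𝕜 := ℝ) unitMeasure (κ t),
      BoundedContinuousFunction.coeFn_toLp (p := ∞) (𝕜 := ℝ) unitMeasure (ν t),
      ContinuousLinearMap.coeFn_holder (r := 2) (ContinuousLinearMap.mul ℝ ℝ) (b (ν t)) (Γ t),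
      ae_mem_unit] with ξ h₁ h₂ h₃ h₄ hξ
    have hξ' := Ioo_subset_Icc_self hξ
    rw [← hκk t ξ hξ', ← hνl t ξ hξ', h₁, Pi.add_apply]
    congr 1
    refine h₄.trans ?_
    rw [ContinuousLinearMap.mul_apply']
    exact congrArg (· * _) h₃

/-- If `Z(t)(ξ) - Z(0)(ξ) = ∫₀ᵗ k(ξ,r) dr` for almost every `ξ` and `k(·,r)` represents a continuous
curve `Γ` in `L²`, then `Z` is differentiable as a curve in `L²`, with derivative `Γ`. -/
theorem hasDerivAt_of_ae_integral {Z Γ : ℝ → L2} (hΓ : Continuous Γ) {k : ℝ → ℝ → ℝ}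
    (hk : Measurable (fun p : ℝ × ℝ => k p.1 p.2))
    (hΓk : ∀ r, ∀ᵐ ξ ∂unitMeasure, Γ r ξ = k ξ r)
    (hZ : ∀ t, ∀ᵐ ξ ∂unitMeasure, Z t ξ - Z 0 ξ = ∫ r in (0 : ℝ)..t, k ξ r) (t : ℝ) :
    HasDerivAt Z (Γ t) t := by
  have main : ∀ t, Z t = Z 0 + ∫ r in (0 : ℝ)..t, Γ r := by
    intro t
    have hkm : Measurable (Function.uncurry fun r ξ => k ξ r) := hk.comp measurable_swap
    have hint : Integrable (Function.uncurry fun r ξ => k ξ r)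
        ((volume.restrict (uIoc 0 t)).prod unitMeasure) := by
      rw [integrable_prod_iff hkm.aestronglyMeasurable]
      constructor
      · exact Eventually.of_forall fun r => (integrable_L2 (Γ r)).congr (hΓk r)
      · have hn : Integrable (fun r => ‖Γ r‖) (volume.restrict (uIoc 0 t)) :=
          (hΓ.norm.integrableOn_uIcc (a := 0) (b := t)).mono_set uIoc_subset_uIcc
        refine hn.mono (hkm.norm.stronglyMeasurable.integral_prod_right).aestronglyMeasurable
          (Eventually.of_forall fun r => ?_)
        -- Cauchy-Schwarz on the unit interval: the `L¹` norm is at most the `L²` norm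
        have h1 : ∫ ξ, ‖k ξ r‖ ∂unitMeasure ≤ ‖Γ r‖ := by
          have e : ∫ ξ, ‖k ξ r‖ ∂unitMeasure = ∫ ξ, ‖Γ r ξ‖ ∂unitMeasure :=
            integral_congr_ae (by filter_upwards [hΓk r] with ξ hξ using by simp only [hξ])
          rw [e, integral_norm_eq_lintegral_enorm (Lp.aestronglyMeasurable _), Lp.norm_def]
          refine ENNReal.toReal_mono (Lp.eLpNorm_ne_top _) ?_
          rw [← eLpNorm_one_eq_lintegral_enorm]
          have : IsProbabilityMeasure unitMeasure := ⟨by simp⟩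
          exact eLpNorm_le_eLpNorm_of_exponent_le (by norm_num) (Lp.aestronglyMeasurable _)
        have h0 : 0 ≤ ∫ ξ, ‖k ξ r‖ ∂unitMeasure := integral_nonneg fun _ => norm_nonneg _
        rw [norm_norm]
        refine le_trans (le_of_eq ?_) h1
        exact Real.norm_of_nonneg h0
    have hkint : Integrable (fun ξ => ∫ r in (0 : ℝ)..t, k ξ r) unitMeasure := by
      refine ((integrable_L2 (Z t)).sub (integrable_L2 (Z 0))).congr ?_
      filter_upwards [hZ t] with ξ hξ using hξ
    have key : ∀ᵐ ξ ∂unitMeasure, (∫ r in (0 : ℝ)..t, Γ r : L2) ξ = ∫ r in (0 : ℝ)..t, k ξ r := by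
      refine Integrable.ae_eq_of_forall_setIntegral_eq _ _ (integrable_L2 _) hkint
        fun s hs hμs => ?_
      have hii : IntervalIntegrable Γ volume 0 t := hΓ.intervalIntegrable 0 t
      have e₁ := (innerSL ℝ (indicatorConstLp 2 hs hμs.ne (1 : ℝ))).intervalIntegral_comp_comm hii
      simp only [innerSL_apply_apply, L2.inner_indicatorConstLp_one] at e₁
      have hsw : ∫ r in (0 : ℝ)..t, ∫ ξ, k ξ r ∂(unitMeasure.restrict s) =
          ∫ ξ, (∫ r in (0 : ℝ)..t, k ξ r) ∂(unitMeasure.restrict s) := by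
        refine intervalIntegral_integral_swap (f := fun r ξ => k ξ r) (hint.mono_measure ?_)
        exact Measure.prod_mono le_rfl Measure.restrict_le_self
      rw [← e₁, ← hsw]
      refine intervalIntegral.integral_congr fun r _ => ?_
      exact integral_congr_ae (ae_restrict_of_ae (hΓk r))
    refine Lp.ext ?_
    filter_upwards [hZ t, key, Lp.coeFn_add (Z 0) (∫ r in (0 : ℝ)..t, Γ r)] with ξ h₁ h₂ h₃
    rw [h₃, Pi.add_apply, h₂, ← h₁]
    ring
  rw [funext main]
  exact ((hΓ.integral_hasStrictDerivAt 0 t).hasDerivAt).const_add _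

/-! ### Travel time and integration along characteristics -/

/-- `k(ξ,t)` is jointly continuous, and has the jointly continuous partial derivative `kt` in the
time `t`. -/
structure IsC1Time (k kt : ℝ → ℝ → ℝ) : Prop where
  cont : Continuous fun p : ℝ × ℝ => k p.1 p.2
  cont_deriv : Continuous fun p : ℝ × ℝ => kt p.1 p.2
  hasDerivAt : ∀ ξ t, HasDerivAt (k ξ) (kt ξ t) t

/-- `k(ξ,t)` is jointly continuously differentiable, with partial derivatives `kx` in `ξ` and `kt`
in `t`. -/
structure IsC1SpaceTime (k kx kt : ℝ → ℝ → ℝ) : Prop extends IsC1Time k kt where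
  cont_deriv_space : Continuous fun p : ℝ × ℝ => kx p.1 p.2
  hasDerivAt_space : ∀ ξ t, HasDerivAt (fun y => k y t) (kx ξ t) ξ

theorem IsC1Time.mul {k kt l lt : ℝ → ℝ → ℝ} (hk : IsC1Time k kt) (hl : IsC1Time l lt) :
    IsC1Time (fun ξ t => k ξ t * l ξ t) (fun ξ t => kt ξ t * l ξ t + k ξ t * lt ξ t) :=
  ⟨hk.cont.mul hl.cont, (hk.cont_deriv.mul hl.cont).add (hk.cont.mul hl.cont_deriv),
    fun ξ t => (hk.hasDerivAt ξ t).mul (hl.hasDerivAt ξ t)⟩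

theorem IsC1SpaceTime.exp {k kx kt : ℝ → ℝ → ℝ} (hk : IsC1SpaceTime k kx kt) :
    IsC1SpaceTime (fun ξ t => Real.exp (k ξ t)) (fun ξ t => Real.exp (k ξ t) * kx ξ t)
      (fun ξ t => Real.exp (k ξ t) * kt ξ t) where
  cont := hk.cont.rexp
  cont_deriv := hk.cont.rexp.mul hk.cont_deriv
  hasDerivAt ξ t := (hk.hasDerivAt ξ t).exp
  cont_deriv_space := hk.cont.rexp.mul hk.cont_deriv_space
  hasDerivAt_space ξ t := (hk.hasDerivAt_space ξ t).exp

theorem IsC1SpaceTime.neg {k kx kt : ℝ → ℝ → ℝ} (hk : IsC1SpaceTime k kx kt) :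
    IsC1SpaceTime (fun ξ t => -k ξ t) (fun ξ t => -kx ξ t) (fun ξ t => -kt ξ t) where
  cont := hk.cont.neg
  cont_deriv := hk.cont_deriv.neg
  hasDerivAt ξ t := (hk.hasDerivAt ξ t).neg
  cont_deriv_space := hk.cont_deriv_space.neg
  hasDerivAt_space ξ t := (hk.hasDerivAt_space ξ t).neg

/-- `τ` is the travel time of the transport with slowness `W = 1 / V`: the time in which a particle
moves from `0` to `ξ`. The slowness is bounded, and bounded away from zero, on the whole line. -/
structure IsTravelTime (W τ : ℝ → ℝ) (m M : ℝ≥0) : Prop where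
  cont : Continuous W
  pos : 0 < m
  lower : ∀ ξ, m ≤ W ξ
  upper : ∀ ξ, W ξ ≤ M
  hasDerivAt : ∀ ξ, HasDerivAt τ (W ξ) ξ
  zero : τ 0 = 0

namespace IsTravelTime

variable {W τ : ℝ → ℝ} {m M : ℝ≥0}

theorem slowness_pos (h : IsTravelTime W τ m M) (ξ : ℝ) : 0 < W ξ :=
  lt_of_lt_of_le (NNReal.coe_pos.2 h.pos) (h.lower ξ)

theorem continuous (h : IsTravelTime W τ m M) : Continuous τ :=
  continuous_iff_continuousAt.2 fun ξ => (h.hasDerivAt ξ).continuousAt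

theorem strictMono (h : IsTravelTime W τ m M) : StrictMono τ :=
  strictMono_of_deriv_pos fun ξ => by
    rw [(h.hasDerivAt ξ).deriv]
    exact h.slowness_pos ξ

theorem lipschitz (h : IsTravelTime W τ m M) : LipschitzWith M τ := by
  refine lipschitzWith_of_nnnorm_deriv_le (fun ξ => (h.hasDerivAt ξ).differentiableAt) fun ξ => ?_
  rw [(h.hasDerivAt ξ).deriv, ← NNReal.coe_le_coe, coe_nnnorm,
    Real.norm_of_nonneg (h.slowness_pos ξ).le]
  exact h.upper ξ

theorem mul_sub_le (h : IsTravelTime W τ m M) {x y : ℝ} (hxy : x ≤ y) :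
    m * (y - x) ≤ τ y - τ x :=
  mul_sub_le_image_sub_of_le_deriv (fun ξ => (h.hasDerivAt ξ).differentiableAt)
    (fun ξ => (h.hasDerivAt ξ).deriv ▸ h.lower ξ) hxy

theorem antilipschitz (h : IsTravelTime W τ m M) : AntilipschitzWith m⁻¹ τ := by
  refine AntilipschitzWith.of_le_mul_dist fun x y => ?_
  have hm : (0 : ℝ) < m := NNReal.coe_pos.2 h.pos
  rw [NNReal.coe_inv, inv_mul_eq_div, le_div_iff₀ hm, Real.dist_eq, Real.dist_eq, mul_comm]
  rcases le_total x y with hxy | hxy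
  · have := h.mul_sub_le hxy
    rw [abs_sub_comm, abs_of_nonneg (sub_nonneg.2 hxy), abs_sub_comm]
    exact this.trans (le_abs_self _)
  · have := h.mul_sub_le hxy
    rw [abs_of_nonneg (sub_nonneg.2 hxy)]
    exact this.trans (le_abs_self _)

theorem surjective (h : IsTravelTime W τ m M) : Function.Surjective τ := by
  have hm : (0 : ℝ) < m := NNReal.coe_pos.2 h.pos
  refine h.continuous.surjective ?_ ?_
  · refine tendsto_atTop_mono' _ ?_ (tendsto_id.const_mul_atTop hm)
    filter_upwards [eventually_ge_atTop 0] with x hx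
    have := h.mul_sub_le hx
    rw [h.zero] at this
    simpa using this
  · refine tendsto_atBot_mono' _ ?_ (tendsto_id.const_mul_atBot hm)
    filter_upwards [eventually_le_atBot 0] with x hx
    have := h.mul_sub_le hx
    rw [h.zero] at this
    simp only [id]
    linarith

/-- The inverse of the travel time is antilipschitz. -/
theorem exists_inverse (h : IsTravelTime W τ m M) :
    ∃ ρ : ℝ → ℝ, AntilipschitzWith M ρ ∧ Measurable ρ ∧ ∀ ξ, ρ (τ ξ) = ξ := by
  let e := h.strictMono.orderIsoOfSurjective τ h.surjective
  have hl : ∀ ξ, e.symm (τ ξ) = ξ := fun ξ => e.symm_apply_apply ξ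
  have hr : ∀ x, τ (e.symm x) = x := fun x => e.apply_symm_apply x
  exact ⟨e.symm, h.lipschitz.to_rightInverse hr, e.symm.monotone.measurable, hl⟩

/-- Substitution `x = τ(ξ) - t`, for an arbitrary integrand. -/
theorem integral_comp (h : IsTravelTime W τ m M) (γ : ℝ → ℝ) (t a b : ℝ) :
    ∫ y in a..b, γ (τ y - t) * W y = ∫ x in (τ a - t)..(τ b - t), γ x :=
  intervalIntegral.integral_comp_mul_deriv_of_deriv_nonneg (f := fun y => τ y - t)
    (h.continuous.sub continuous_const).continuousOn
    (fun y _ => (h.hasDerivAt y).sub_const t) fun y _ => (h.slowness_pos y).le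

end IsTravelTime

/-- Integration along characteristics: `∫₀^ξ k(y, t - τ(ξ) + τ(y)) W(y) dy` is the solution of
`∂u/∂t + W⁻¹ ∂u/∂ξ = k` that vanishes at `ξ = 0`. -/
noncomputable def charIntegral (W τ : ℝ → ℝ) (k : ℝ → ℝ → ℝ) (ξ t : ℝ) : ℝ :=
  ∫ y in (0 : ℝ)..ξ, k y (t - τ ξ + τ y) * W y

theorem charIntegral_zero (W τ : ℝ → ℝ) (k : ℝ → ℝ → ℝ) (t : ℝ) : charIntegral W τ k 0 t = 0 := by
  simp [charIntegral]

theorem continuous_integral_shift {W τ : ℝ → ℝ} {m M : ℝ≥0} (h : IsTravelTime W τ m M)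
    {k : ℝ → ℝ → ℝ} (hk : Continuous fun p : ℝ × ℝ => k p.1 p.2) :
    Continuous fun p : ℝ × ℝ => ∫ y in (0 : ℝ)..p.1, k y (p.2 + τ y) * W y := by
  have hτ := h.continuous
  have hW := h.cont
  refine intervalIntegral.continuous_parametric_intervalIntegral_of_continuous
    (f := fun (p : ℝ × ℝ) y => k y (p.2 + τ y) * W y) ?_ continuous_fst
  exact (hk.comp (Continuous.prodMk continuous_snd
    ((continuous_snd.comp continuous_fst).add (hτ.comp continuous_snd)))).mul
    (hW.comp continuous_snd)

theorem hasDerivAt_integral_shift {W τ : ℝ → ℝ} {m M : ℝ≥0} (h : IsTravelTime W τ m M)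
    {k kt : ℝ → ℝ → ℝ} (hk : IsC1Time k kt) (ξ s : ℝ) :
    HasDerivAt (fun s => ∫ y in (0 : ℝ)..ξ, k y (s + τ y) * W y)
      (∫ y in (0 : ℝ)..ξ, kt y (s + τ y) * W y) s := by
  have hτ := h.continuous
  have hW := h.cont
  have hc : ∀ {l : ℝ → ℝ → ℝ}, (Continuous fun p : ℝ × ℝ => l p.1 p.2) →
      Continuous fun p : ℝ × ℝ => l p.2 (p.1 + τ p.2) * W p.2 := fun hl =>
    (hl.comp (Continuous.prodMk continuous_snd (continuous_fst.add (hτ.comp continuous_snd)))).mul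
      (hW.comp continuous_snd)
  have hc' : ∀ {l : ℝ → ℝ → ℝ}, (Continuous fun p : ℝ × ℝ => l p.1 p.2) →
      ∀ s, Continuous fun y => l y (s + τ y) * W y := fun hl s =>
    (hc hl).comp (Continuous.prodMk continuous_const continuous_id)
  obtain ⟨C, hC⟩ := ((isCompact_closedBall s 1).prod
    (isCompact_uIcc (a := (0 : ℝ)) (b := ξ))).exists_bound_of_continuousOn
    (hc hk.cont_deriv).continuousOn
  refine (intervalIntegral.hasDerivAt_integral_of_dominated_loc_of_deriv_le
    (F := fun s y => k y (s + τ y) * W y) (F' := fun s y => kt y (s + τ y) * W y)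
    (bound := fun _ => C) (Metric.ball_mem_nhds s one_pos)
    (Eventually.of_forall fun s => (hc' hk.cont s).aestronglyMeasurable)
    ((hc' hk.cont s).intervalIntegrable _ _) (hc' hk.cont_deriv s).aestronglyMeasurable
    (Eventually.of_forall fun y hy x hx => hC (x, y)
      ⟨Metric.ball_subset_closedBall hx, uIoc_subset_uIcc hy⟩)
    intervalIntegrable_const (Eventually.of_forall fun y _ x _ => ?_)).2
  exact ((hk.hasDerivAt y (x + τ y)).comp_add_const x (τ y)).mul_const _

/-- The integral along characteristics is continuously differentiable, although the integrand need
not be differentiable in space. -/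
theorem isC1SpaceTime_charIntegral {W τ : ℝ → ℝ} {m M : ℝ≥0} (h : IsTravelTime W τ m M)
    {k kt : ℝ → ℝ → ℝ} (hk : IsC1Time k kt) :
    IsC1SpaceTime (charIntegral W τ k)
      (fun ξ t => W ξ * (k ξ t - charIntegral W τ kt ξ t)) (charIntegral W τ kt) := by
  have hτ := h.continuous
  have hW := h.cont
  have hQ : ∀ {l : ℝ → ℝ → ℝ}, (Continuous fun p : ℝ × ℝ => l p.1 p.2) →
      Continuous fun p : ℝ × ℝ => charIntegral W τ l p.1 p.2 := fun hl =>
    (continuous_integral_shift h hl).comp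
      (Continuous.prodMk continuous_fst (continuous_snd.sub (hτ.comp continuous_fst)))
  refine ⟨⟨hQ hk.cont, hQ hk.cont_deriv, fun ξ t => ?_⟩,
    (hW.comp continuous_fst).mul (hk.cont.sub (hQ hk.cont_deriv)), fun ξ t => ?_⟩
  · exact (hasDerivAt_integral_shift h hk ξ (t - τ ξ)).comp_sub_const t (τ ξ)
  -- `B(x,s) = ∫₀^x k(y, s + τ(y)) W(y) dy` has continuous partial derivatives
  · let B : ℝ → ℝ → ℝ := fun x s => ∫ y in (0 : ℝ)..x, k y (s + τ y) * W y
    let B₁ : ℝ → ℝ → ℝ →L[ℝ] ℝ := fun x s =>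
      ContinuousLinearMap.toSpanSingleton ℝ (k x (s + τ x) * W x)
    let B₂ : ℝ → ℝ → ℝ →L[ℝ] ℝ := fun x s =>
      ContinuousLinearMap.toSpanSingleton ℝ (∫ y in (0 : ℝ)..x, kt y (s + τ y) * W y)
    have hts : Continuous fun c : ℝ => ContinuousLinearMap.toSpanSingleton ℝ c :=
      LinearMap.continuous_of_finiteDimensional
        (ContinuousLinearMap.toSpanSingletonLE ℝ ℝ ℝ).toLinearMap
    have c₁ : Continuous (Function.uncurry B₁) := by
      refine hts.comp ?_
      exact (hk.cont.comp (Continuous.prodMk continuous_fst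
        (continuous_snd.add (hτ.comp continuous_fst)))).mul (hW.comp continuous_fst)
    have c₂ : Continuous (Function.uncurry B₂) :=
      hts.comp (continuous_integral_shift h hk.cont_deriv)
    have hB := hasStrictFDerivAt_uncurry_coprod (𝕜 := ℝ) (u := (ξ, t - τ ξ)) (f := B)
      (f₁ := B₁) (f₂ := B₂) (Eventually.of_forall fun p => ?_) (Eventually.of_forall fun p => ?_)
      c₁.continuousAt c₂.continuousAt
    · have hg : HasDerivAt (fun x => (x, t - τ x)) ((1 : ℝ), -W ξ) ξ :=
        (hasDerivAt_id ξ).prodMk ((h.hasDerivAt ξ).const_sub t)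
      have := HasFDerivAt.comp_hasDerivAt ξ hB.hasFDerivAt hg
      refine this.congr_deriv ?_
      change (1 : ℝ) * (k ξ (t - τ ξ + τ ξ) * W ξ) + -W ξ * charIntegral W τ kt ξ t = _
      rw [sub_add_cancel]
      ring
    · have hc : Continuous fun y => k y (p.2 + τ y) * W y :=
        (hk.cont.comp (Continuous.prodMk continuous_id (continuous_const.add hτ))).mul hW
      exact (hc.integral_hasStrictDerivAt 0 p.1).hasDerivAt.hasFDerivAt
    · exact (hasDerivAt_integral_shift h hk p.1 p.2).hasFDerivAt

/-! ### Existence by the method of characteristics -/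

section Profile

variable {W τ : ℝ → ℝ} {m M : ℝ≥0}

/-- Every absolutely continuous datum `u` on `[0,1]` with `u(0) = 0` and square integrable derivative
is, in the coordinate `x = τ(ξ)`, the primitive of a profile `γ` in `L²(ℝ)` that vanishes on the
negative half-line. -/
theorem exists_profile (h : IsTravelTime W τ m M) {u q : ℝ → ℝ} (hu : HasACDeriv u q 0 1)
    (hu0 : u 0 = 0) (hq : MemLp q 2 unitMeasure) (hqm : Measurable q) :
    ∃ γ : ℝ → ℝ, Measurable γ ∧ MemLp γ 2 volume ∧ (∀ x ≤ 0, γ x = 0) ∧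
      ∀ ξ ∈ Icc (0 : ℝ) 1, ∫ x in (0 : ℝ)..τ ξ, γ x = u ξ := by
  obtain ⟨ρ, hρ, hρm, hρτ⟩ := h.exists_inverse
  set r : ℝ → ℝ := fun y => (Ioo (0 : ℝ) 1).indicator q y * (W y)⁻¹ with hr
  have hWc : Continuous fun y => (W y)⁻¹ := h.cont.inv₀ fun y => (h.slowness_pos y).ne'
  have hrm : Measurable r := (hqm.indicator measurableSet_Ioo).mul hWc.measurable
  have hr2 : MemLp r 2 volume := by
    have h1 : MemLp ((Ioo (0 : ℝ) 1).indicator q) 2 volume :=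
      (memLp_indicator_iff_restrict measurableSet_Ioo).2 hq
    have h2 : MemLp (fun y => (W y)⁻¹) ∞ volume := by
      refine memLp_top_of_bound hWc.aestronglyMeasurable ((m : ℝ)⁻¹)
        (Eventually.of_forall fun y => ?_)
      rw [norm_inv, Real.norm_of_nonneg (h.slowness_pos y).le]
      exact inv_anti₀ (NNReal.coe_pos.2 h.pos) (h.lower y)
    exact h2.mul' h1
  refine ⟨r ∘ ρ, hrm.comp hρm, memLp_comp_antilipschitz hρ hρm hr2, fun x hx => ?_,
    fun ξ hξ => ?_⟩
  · obtain ⟨y, rfl⟩ := h.surjective x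
    have hy : y ≤ 0 := by
      rw [← h.zero] at hx
      exact h.strictMono.le_iff_le.1 hx
    have : y ∉ Ioo (0 : ℝ) 1 := fun hy' => hy'.1.not_ge hy
    simp only [Function.comp_apply, hρτ, hr, indicator_of_notMem this, zero_mul]
  · have e := h.integral_comp (r ∘ ρ) 0 0 ξ
    simp only [sub_zero, h.zero, Function.comp_apply, hρτ] at e
    simp only [Function.comp_apply]
    rw [← e]
    have hsub : uIcc 0 ξ ⊆ uIcc (0 : ℝ) 1 := by
      rw [uIcc_of_le hξ.1, uIcc_of_le zero_le_one]
      exact Icc_subset_Icc_right hξ.2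
    have e₂ := (hu.mono hsub).integral_eq
    rw [hu0, sub_zero] at e₂
    rw [← e₂]
    refine intervalIntegral.integral_congr_ae ?_
    have h1 : ∀ᵐ y : ℝ, y ≠ 1 := by simp [ae_iff, measure_singleton]
    filter_upwards [h1] with y hy hy'
    rw [uIoc_of_le hξ.1] at hy'
    rw [hr]
    simp only
    have hmem : y ∈ Ioo (0 : ℝ) 1 := ⟨hy'.1, lt_of_le_of_ne (hy'.2.trans hξ.2) hy⟩
    rw [indicator_of_mem hmem, mul_assoc,
      inv_mul_cancel₀ (h.slowness_pos y).ne', mul_one]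

theorem locallyIntegrable_of_memLp_two {f : ℝ → ℝ} (hf : MemLp f 2 volume) :
    LocallyIntegrable f volume :=
  hf.locallyIntegrable (by norm_num)

theorem intervalIntegrable_of_memLp_two {f : ℝ → ℝ} (hf : MemLp f 2 volume) (a b : ℝ) :
    IntervalIntegrable f volume a b :=
  intervalIntegrable_iff.2 (((locallyIntegrable_of_memLp_two hf).integrableOn_isCompact
    isCompact_uIcc).mono_set uIoc_subset_uIcc)

theorem continuous_primitive_of_memLp_two {γ : ℝ → ℝ} (hγ : MemLp γ 2 volume) :
    Continuous fun x => ∫ y in (0 : ℝ)..x, γ y :=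
  intervalIntegral.continuous_primitive (intervalIntegrable_of_memLp_two hγ) 0

theorem memLp_sub_const {γ : ℝ → ℝ} (hγ : MemLp γ 2 volume) (t : ℝ) :
    MemLp (fun x => γ (x - t)) 2 volume :=
  hγ.comp_measurePreserving (measurePreserving_sub_right volume t)

theorem memLp_const_sub {γ : ℝ → ℝ} (hγ : MemLp γ 2 volume) (c : ℝ) :
    MemLp (fun x => γ (c - x)) 2 volume :=
  hγ.comp_measurePreserving (Measure.measurePreserving_sub_left volume c)

/-- The transported primitive `G(τ(ξ) - t)`, as a function of `ξ`. -/
theorem hasACDeriv_transport_space (h : IsTravelTime W τ m M) {γ : ℝ → ℝ}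
    (hγ : MemLp γ 2 volume) (t a b : ℝ) :
    HasACDeriv (fun ξ => ∫ x in (0 : ℝ)..(τ ξ - t), γ x) (fun ξ => γ (τ ξ - t) * W ξ) a b := by
  have hm : MemLp (fun ξ => γ (τ ξ - t) * W ξ) 2 volume := by
    have h1 : MemLp (fun ξ => γ (τ ξ - t)) 2 volume :=
      memLp_comp_antilipschitz h.antilipschitz h.continuous.measurable (memLp_sub_const hγ t)
    have h2 : MemLp W ∞ volume := by
      refine memLp_top_of_bound h.cont.aestronglyMeasurable M (Eventually.of_forall fun y => ?_)
      rw [Real.norm_of_nonneg (h.slowness_pos y).le]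
      exact h.upper y
    exact h2.mul' h1
  have := HasACDeriv.primitive (a := a) (b := b) (locallyIntegrable_of_memLp_two hm) 0
    (∫ x in (0 : ℝ)..(τ 0 - t), γ x)
  refine this.congr fun ξ => ?_
  rw [h.integral_comp, intervalIntegral.integral_add_adjacent_intervals
    (intervalIntegrable_of_memLp_two hγ _ _) (intervalIntegrable_of_memLp_two hγ _ _)]

/-- The transported primitive `G(c - t)`, as a function of `t`. -/
theorem hasACDeriv_transport_time {γ : ℝ → ℝ} (hγ : MemLp γ 2 volume) (c a b : ℝ) :
    HasACDeriv (fun t => ∫ x in (0 : ℝ)..(c - t), γ x) (fun t => -γ (c - t)) a b := by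
  have := HasACDeriv.primitive (a := a) (b := b)
    (locallyIntegrable_of_memLp_two (memLp_const_sub hγ c).neg) 0
    (∫ x in (0 : ℝ)..c, γ x)
  refine this.congr fun t => ?_
  simp only [Pi.neg_apply]
  rw [intervalIntegral.integral_neg, intervalIntegral.integral_comp_sub_left (fun x => γ x) c,
    sub_zero, ← intervalIntegral.integral_symm, intervalIntegral.integral_add_adjacent_intervals
    (intervalIntegrable_of_memLp_two hγ _ _) (intervalIntegrable_of_memLp_two hγ _ _)]

end Profile

theorem IsC1SpaceTime.hasACDeriv_space {k kx kt : ℝ → ℝ → ℝ} (hk : IsC1SpaceTime k kx kt)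
    (t a b : ℝ) : HasACDeriv (fun ξ => k ξ t) (fun ξ => kx ξ t) a b :=
  .of_hasDerivAt (fun ξ => hk.hasDerivAt_space ξ t)
    (hk.cont_deriv_space.comp (Continuous.prodMk continuous_id continuous_const))

theorem IsC1Time.hasACDeriv_time {k kt : ℝ → ℝ → ℝ} (hk : IsC1Time k kt)
    (ξ a b : ℝ) : HasACDeriv (fun t => k ξ t) (fun t => kt ξ t) a b :=
  .of_hasDerivAt (fun t => hk.hasDerivAt ξ t)
    (hk.cont_deriv.comp (Continuous.prodMk continuous_const continuous_id))

theorem continuous_curve_H1 {z : ℝ → H1} (h₁ : Continuous fun t => (z t).toL2)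
    (h₂ : Continuous fun t => (z t).weakDeriv) : Continuous z :=
  continuous_induced_rng.2
    ((WithLp.prod_continuous_toLp 2 L2 L2).comp (h₁.prodMk h₂))

/-- A product `E(ξ,t) (P(ξ,t) + G(τ(ξ) - t))` of a continuously differentiable function with a
transported primitive `G` of `γ ∈ L²(ℝ)` is continuous in time with values in `H¹`, and
continuously differentiable with values in `L²`. -/
theorem exists_H1_curve {W τ : ℝ → ℝ} {m M : ℝ≥0} (h : IsTravelTime W τ m M)
    {E Ex Et P Px Pt : ℝ → ℝ → ℝ} (hE : IsC1SpaceTime E Ex Et) (hP : IsC1SpaceTime P Px Pt)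
    {γ : ℝ → ℝ} (hγm : Measurable γ) (hγ : MemLp γ 2 volume) :
    ∃ (z : ℝ → H1) (Z' : ℝ → L2), Continuous z ∧ Continuous Z' ∧
      (∀ t, HasDerivAt (fun s => (z s).toL2) (Z' t) t) ∧
      (∀ t, ∀ᵐ ξ ∂unitMeasure, (z t).toL2 ξ = E ξ t * (P ξ t + ∫ x in (0 : ℝ)..(τ ξ - t), γ x)) ∧
      (∀ t, ∀ᵐ ξ ∂unitMeasure, (z t).weakDeriv ξ =
        Ex ξ t * (P ξ t + ∫ x in (0 : ℝ)..(τ ξ - t), γ x) +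
          E ξ t * (Px ξ t + γ (τ ξ - t) * W ξ)) ∧
      (∀ t, ∀ᵐ ξ ∂unitMeasure, Z' t ξ =
        Et ξ t * (P ξ t + ∫ x in (0 : ℝ)..(τ ξ - t), γ x) +
          E ξ t * (Pt ξ t + -γ (τ ξ - t))) := by
  obtain ⟨Γ, hΓ, hΓγ⟩ :=
    exists_continuous_translate h.antilipschitz h.continuous.measurable hγ
  have hG : Continuous fun p : ℝ × ℝ => ∫ x in (0 : ℝ)..(τ p.1 - p.2), γ x :=
    (continuous_primitive_of_memLp_two hγ).comp
      ((h.continuous.comp continuous_fst).sub continuous_snd)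
  have hPG := hP.cont.add hG
  have hW : Continuous fun p : ℝ × ℝ => W p.1 := h.cont.comp continuous_fst
  obtain ⟨Z, hZ, hZe⟩ := exists_continuous_affine
    (k := fun ξ t => E ξ t * (P ξ t + ∫ x in (0 : ℝ)..(τ ξ - t), γ x)) (l := fun _ _ => 0)
    (hE.cont.mul hPG) continuous_const hΓ
  obtain ⟨Zx, hZx, hZxe⟩ := exists_continuous_affine
    (k := fun ξ t => Ex ξ t * (P ξ t + ∫ x in (0 : ℝ)..(τ ξ - t), γ x) + E ξ t * Px ξ t)
    (l := fun ξ t => E ξ t * W ξ)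
    ((hE.cont_deriv_space.mul hPG).add (hE.cont.mul hP.cont_deriv_space)) (hE.cont.mul hW) hΓ
  obtain ⟨Zt, hZt, hZte⟩ := exists_continuous_affine
    (k := fun ξ t => Et ξ t * (P ξ t + ∫ x in (0 : ℝ)..(τ ξ - t), γ x) + E ξ t * Pt ξ t)
    (l := fun ξ t => -E ξ t)
    ((hE.cont_deriv.mul hPG).add (hE.cont.mul hP.cont_deriv)) hE.cont.neg hΓ
  have eZ : ∀ t, ∀ᵐ ξ ∂unitMeasure,
      Z t ξ = E ξ t * (P ξ t + ∫ x in (0 : ℝ)..(τ ξ - t), γ x) := fun t => by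
    filter_upwards [hZe t] with ξ hξ
    rw [hξ, zero_mul, add_zero]
  have eZx : ∀ t, ∀ᵐ ξ ∂unitMeasure, Zx t ξ =
      Ex ξ t * (P ξ t + ∫ x in (0 : ℝ)..(τ ξ - t), γ x) +
        E ξ t * (Px ξ t + γ (τ ξ - t) * W ξ) := fun t => by
    filter_upwards [hZxe t, hΓγ t] with ξ hξ hξ'
    rw [hξ, hξ']
    ring
  have eZt : ∀ t, ∀ᵐ ξ ∂unitMeasure, Zt t ξ =
      Et ξ t * (P ξ t + ∫ x in (0 : ℝ)..(τ ξ - t), γ x) +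
        E ξ t * (Pt ξ t + -γ (τ ξ - t)) := fun t => by
    filter_upwards [hZte t, hΓγ t] with ξ hξ hξ'
    rw [hξ, hξ']
    ring
  have hweak : ∀ t, IsWeakDeriv (Z t) (Zx t) := fun t =>
    ((hE.hasACDeriv_space t 0 1).mul ((hP.hasACDeriv_space t 0 1).add
      (hasACDeriv_transport_space h hγ t 0 1))).isWeakDeriv (eZ t) (eZx t)
  refine ⟨fun t => ⟨WithLp.toLp 2 (Z t, Zx t), hweak t⟩, Zt, continuous_curve_H1 hZ hZx, hZt,
    hasDerivAt_of_ae_integral hZt (k := fun ξ t =>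
      Et ξ t * (P ξ t + ∫ x in (0 : ℝ)..(τ ξ - t), γ x) + E ξ t * (Pt ξ t + -γ (τ ξ - t)))
      ?_ eZt fun t => ?_, eZ, eZx, eZt⟩
  · refine (hE.cont_deriv.mul hPG).measurable.add (hE.cont.measurable.mul
      (hP.cont_deriv.measurable.add (hγm.comp ?_).neg))
    exact ((h.continuous.comp continuous_fst).sub continuous_snd).measurable
  · filter_upwards [eZ t, eZ 0] with ξ h₁ h₂
    refine Eq.trans (congrArg₂ _ h₁ h₂) ?_
    exact ((hE.hasACDeriv_time ξ 0 t).mul ((hP.hasACDeriv_time ξ 0 t).add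
      (hasACDeriv_transport_time hγ (τ ξ) 0 t))).integral_eq.symm

/-- Existence for the transport equation `∂z/∂t + W⁻¹ ∂z/∂ξ = -α z + β`, on all of `ℝ` in time. -/
theorem exists_transport_solution {W τ : ℝ → ℝ} {m M : ℝ≥0} (h : IsTravelTime W τ m M)
    {α αt β βt : ℝ → ℝ → ℝ} (hα : IsC1Time α αt) (hβ : IsC1Time β βt)
    (z₀ : H1) (hz₀ : z₀.VanishesAtZero) :
    ∃ (z : ℝ → H1) (Z' : ℝ → L2), Continuous z ∧ Continuous Z' ∧
      (∀ t, HasDerivAt (fun s => (z s).toL2) (Z' t) t) ∧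
      (∀ t, ∀ᵐ ξ ∂unitMeasure, W ξ * Z' t ξ + (z t).weakDeriv ξ =
        W ξ * (-(α ξ t) * (z t).toL2 ξ + β ξ t)) ∧
      (∀ t, 0 ≤ t → (z t).VanishesAtZero) ∧ z 0 = z₀ := by
  -- The integrating factor `exp A` turns the damping term into a modification of the source
  have hA := isC1SpaceTime_charIntegral h hα
  set A := charIntegral W τ α with hAdef
  have hH := hβ.mul hA.exp.toIsC1Time
  have hP := isC1SpaceTime_charIntegral h hH
  set P := charIntegral W τ (fun ξ t => β ξ t * Real.exp (A ξ t)) with hPdef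
  have hE := hA.neg.exp
  have hF := z₀.hasACDeriv_primitive 0 1
  have hFc := z₀.continuous_primitive
  set F : ℝ → ℝ := fun ξ => ∫ y in (0 : ℝ)..ξ, z₀.derivExt y with hFdef
  -- `exp A · z₀ - P` at time `0` is the datum that `G(τ(ξ))` has to match
  have hu := (hF.mul (hA.exp.hasACDeriv_space 0 0 1)).sub (hP.hasACDeriv_space 0 0 1)
  have s₀ : Continuous fun ξ : ℝ => (ξ, (0 : ℝ)) :=
    Continuous.prodMk continuous_id continuous_const
  have hpm : Measurable z₀.derivExt :=
    (Lp.stronglyMeasurable z₀.weakDeriv).measurable.indicator measurableSet_Ioo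
  have hpL : MemLp z₀.derivExt 2 unitMeasure :=
    (Lp.memLp z₀.weakDeriv).ae_eq z₀.ae_derivExt_eq
  have bdd : ∀ {f : ℝ → ℝ}, Continuous f → MemLp f ∞ unitMeasure := fun {f} hf => by
    obtain ⟨C, hC⟩ := isCompact_Icc.exists_bound_of_continuousOn (s := Icc (0 : ℝ) 1)
      hf.continuousOn
    refine memLp_top_of_bound hf.aestronglyMeasurable C ?_
    filter_upwards [ae_mem_unit] with ξ hξ using hC ξ (Ioo_subset_Icc_self hξ)
  have c1 := hA.exp.cont.comp s₀
  have c2 := hFc.mul (hA.exp.cont_deriv_space.comp s₀)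
  have c3 := hP.cont_deriv_space.comp s₀
  obtain ⟨γ, hγm, hγ, hγ0, hγu⟩ := exists_profile h hu
    (by simp [hFdef, hPdef, charIntegral_zero])
    ((((bdd c1).mul' hpL).add ((bdd c2).mono_exponent le_top)).sub
      ((bdd c3).mono_exponent le_top))
    (((hpm.mul c1.measurable).add c2.measurable).sub c3.measurable)
  obtain ⟨z, Z', hz, hZ', hd, ez, ezx, ezt⟩ := exists_H1_curve h hE hP hγm hγ
  refine ⟨z, Z', hz, hZ', hd, fun t => ?_, fun t ht => ?_, ?_⟩
  · filter_upwards [ez t, ezx t, ezt t] with ξ h₁ h₂ h₃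
    have hee : Real.exp (-A ξ t) * Real.exp (A ξ t) = 1 := by
      rw [← Real.exp_add, neg_add_cancel, Real.exp_zero]
    rw [h₁, h₂, h₃]
    linear_combination W ξ * β ξ t * hee
  · refine ⟨fun ξ => Real.exp (-A ξ t) * (P ξ t + ∫ x in (0 : ℝ)..(τ ξ - t), γ x), ?_, ez t, ?_⟩
    · have s : Continuous fun ξ : ℝ => (ξ, t) := Continuous.prodMk continuous_id continuous_const
      exact ((hE.cont.comp s).mul ((hP.cont.comp s).add
        ((continuous_primitive_of_memLp_two hγ).comp
          (h.continuous.sub continuous_const)))).continuousOn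
    -- for `t ≥ 0` only values of `γ` on the negative half-line enter at `ξ = 0`
    · have e : ∫ x in (0 : ℝ)..(τ 0 - t), γ x = 0 := by
        rw [h.zero, zero_sub]
        refine (intervalIntegral.integral_congr (g := fun _ => 0) fun x hx => hγ0 x ?_).trans
          (by simp)
        rw [uIcc_of_ge (by linarith)] at hx
        exact hx.2
      simp only [e, hPdef, charIntegral_zero, add_zero, mul_zero]
  · refine H1.ext_toL2 (Lp.ext ?_)
    filter_upwards [ez 0, hz₀.ae_eq_primitive, ae_mem_unit] with ξ h₁ h₂ hξ
    have hee : Real.exp (-A ξ 0) * Real.exp (A ξ 0) = 1 := by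
      rw [← Real.exp_add, neg_add_cancel, Real.exp_zero]
    rw [h₁, h₂, sub_zero, hγu ξ (Ioo_subset_Icc_self hξ)]
    linear_combination F ξ * hee

/-! ### Uniqueness by the energy method -/

/-- Multiplication by a continuous function, as a bounded operator on `L²`. -/
theorem exists_mulOperator {W : ℝ → ℝ} (hW : Continuous W) :
    ∃ B : L2 →L[ℝ] L2, ∀ u, ∀ᵐ ξ ∂unitMeasure, B u ξ = W ξ * u ξ := by
  obtain ⟨κ, -, hκ⟩ := exists_continuous_boundedCurve (k := fun ξ _ => W ξ) (hW.comp continuous_fst)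
  let b := BoundedContinuousFunction.toLp (E := ℝ) ∞ unitMeasure ℝ (κ 0)
  refine ⟨(ContinuousLinearMap.mul ℝ ℝ).holderL unitMeasure ∞ 2 2 b, fun u => ?_⟩
  filter_upwards [BoundedContinuousFunction.coeFn_toLp (p := ∞) (𝕜 := ℝ) unitMeasure (κ 0),
    ContinuousLinearMap.coeFn_holder (r := 2) (ContinuousLinearMap.mul ℝ ℝ) b u,
    ae_mem_unit] with ξ h₁ h₂ hξ
  rw [← hκ 0 ξ (Ioo_subset_Icc_self hξ)]
  refine h₂.trans ?_
  rw [ContinuousLinearMap.mul_apply']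
  exact congrArg (· * _) h₁

theorem integrable_mul_L2 (u w : L2) : Integrable (fun ξ => u ξ * w ξ) unitMeasure :=
  (Lp.memLp u).integrable_mul (Lp.memLp w)

/-- No energy enters through a boundary point where the function vanishes:
`∫₀¹ u u' = u(1)² / 2 ≥ 0`. -/
theorem H1.VanishesAtZero.integral_mul_weakDeriv_nonneg {u : H1} (hu : u.VanishesAtZero) :
    0 ≤ ∫ ξ, u.toL2 ξ * u.weakDeriv ξ ∂unitMeasure := by
  have hF := u.hasACDeriv_primitive 0 1
  have e := (hF.mul hF).integral_eq
  rw [intervalIntegral.integral_same, mul_zero, sub_zero, ← integral_unit_eq] at e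
  have e₂ : ∫ ξ, u.toL2 ξ * u.weakDeriv ξ ∂unitMeasure =
      2⁻¹ * ∫ ξ in Ioo (0 : ℝ) 1, (u.derivExt ξ * (∫ y in (0 : ℝ)..ξ, u.derivExt y) +
        (∫ y in (0 : ℝ)..ξ, u.derivExt y) * u.derivExt ξ) := by
    rw [← integral_const_mul]
    refine integral_congr_ae ?_
    filter_upwards [hu.ae_eq_primitive, u.ae_derivExt_eq] with ξ h₁ h₂
    rw [h₁, h₂]
    ring
  rw [e₂, e]
  exact mul_nonneg (by norm_num) (mul_self_nonneg _)

/-- The weighted energy `∫₀¹ W u²` of a solution of `W ∂u/∂t + ∂u/∂ξ = -W a u` with `a ≥ 0` and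
`u(0,t) = 0` does not increase, so that a solution starting from zero stays zero. -/
theorem toL2_eq_zero_of_transport {W : ℝ → ℝ} (hW : Continuous W) (hW0 : ∀ ξ, 0 < W ξ)
    {a : ℝ → ℝ → ℝ} (ha : ∀ t, ∀ ξ ∈ Ioo (0 : ℝ) 1, 0 ≤ a ξ t) {T : ℝ} {d : ℝ → H1}
    (hc : ContinuousOn (fun t => (d t).toL2) (Icc 0 T))
    (hd : ∀ t ∈ Ioo 0 T, ∃ D' : L2, HasDerivAt (fun s => (d s).toL2) D' t ∧
      ∀ᵐ ξ ∂unitMeasure, W ξ * D' ξ + (d t).weakDeriv ξ = -(W ξ * a ξ t * (d t).toL2 ξ))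
    (hb : ∀ t ∈ Ioo 0 T, (d t).VanishesAtZero) (h0 : (d 0).toL2 = 0) :
    ∀ t ∈ Icc 0 T, (d t).toL2 = 0 := by
  obtain ⟨B, hB⟩ := exists_mulOperator hW
  have hin : ∀ u w : L2, inner ℝ u (B w) = ∫ ξ, W ξ * (u ξ * w ξ) ∂unitMeasure := fun u w => by
    rw [L2.inner_def]
    refine integral_congr_ae ?_
    filter_upwards [hB w] with ξ hξ
    rw [hξ, real_inner_eq_re_inner, RCLike.inner_apply]
    simp only [conj_trivial, RCLike.re_to_real]
    ring
  have hint : ∀ u w : L2, Integrable (fun ξ => W ξ * (u ξ * w ξ)) unitMeasure := fun u w => by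
    refine (integrable_mul_L2 u (B w)).congr ?_
    filter_upwards [hB w] with ξ hξ
    rw [hξ]
    ring
  set En : ℝ → ℝ := fun t => inner ℝ (d t).toL2 (B (d t).toL2) with hEn
  have hEc : ContinuousOn En (Icc 0 T) := hc.inner (𝕜 := ℝ) (B.continuous.comp_continuousOn hc)
  have hEd : ∀ t ∈ Ioo 0 T, ∃ e ≤ 0, HasDerivAt En e t := by
    intro t ht
    obtain ⟨D', hD', hpde⟩ := hd t ht
    refine ⟨_, ?_, hD'.inner ℝ (B.hasFDerivAt.comp_hasDerivAt t hD')⟩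
    rw [hin, hin]
    have hsymm : ∫ ξ, W ξ * (D' ξ * (d t).toL2 ξ) ∂unitMeasure =
        ∫ ξ, W ξ * ((d t).toL2 ξ * D' ξ) ∂unitMeasure := by
      simp only [mul_comm]
    have hle : ∫ ξ, W ξ * ((d t).toL2 ξ * D' ξ) ∂unitMeasure ≤
        ∫ ξ, -((d t).toL2 ξ * (d t).weakDeriv ξ) ∂unitMeasure := by
      refine integral_mono_ae (hint _ _) (integrable_mul_L2 _ _).neg ?_
      filter_upwards [hpde, ae_mem_unit] with ξ hξ hξ'
      have h1 : 0 ≤ W ξ * a ξ t * ((d t).toL2 ξ * (d t).toL2 ξ) :=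
        mul_nonneg (mul_nonneg (hW0 ξ).le (ha t ξ hξ')) (mul_self_nonneg _)
      have h2 : W ξ * D' ξ = -(W ξ * a ξ t * (d t).toL2 ξ) - (d t).weakDeriv ξ := by linarith
      calc W ξ * ((d t).toL2 ξ * D' ξ) = (d t).toL2 ξ * (W ξ * D' ξ) := by ring
        _ = -((d t).toL2 ξ * (d t).weakDeriv ξ)
            - W ξ * a ξ t * ((d t).toL2 ξ * (d t).toL2 ξ) := by rw [h2]; ring
        _ ≤ _ := by linarith
    have hnn := (hb t ht).integral_mul_weakDeriv_nonneg
    rw [integral_neg] at hle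
    rw [hsymm]
    linarith
  have hanti : AntitoneOn En (Icc 0 T) := by
    refine antitoneOn_of_deriv_nonpos (convex_Icc 0 T) hEc ?_ ?_ <;> rw [interior_Icc]
    · intro t ht
      obtain ⟨e, -, he⟩ := hEd t ht
      exact he.differentiableAt.differentiableWithinAt
    · intro t ht
      obtain ⟨e, he0, he⟩ := hEd t ht
      exact he.deriv.trans_le he0
  intro t ht
  have hE0 : En t ≤ 0 := by
    refine (hanti (left_mem_Icc.2 (ht.1.trans ht.2)) ht ht.1).trans_eq ?_
    simp only [hEn, h0, inner_zero_left]
  have hpos : ∀ ξ, 0 ≤ W ξ * ((d t).toL2 ξ * (d t).toL2 ξ) := fun ξ =>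
    mul_nonneg (hW0 ξ).le (mul_self_nonneg _)
  have hz : ∫ ξ, W ξ * ((d t).toL2 ξ * (d t).toL2 ξ) ∂unitMeasure = 0 :=
    le_antisymm ((hin _ _).symm.trans_le hE0) (integral_nonneg hpos)
  rw [integral_eq_zero_iff_of_nonneg hpos (hint _ _)] at hz
  refine Lp.ext ?_
  filter_upwards [hz, Lp.coeFn_zero ℝ 2 unitMeasure] with ξ h₁ h₂
  rw [h₂]
  simpa [(hW0 ξ).ne'] using h₁

theorem H1.VanishesAtZero.sub {u w : H1} (hu : u.VanishesAtZero) (hw : w.VanishesAtZero) :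
    (u - w).VanishesAtZero := by
  obtain ⟨f, hf, hfu, hf0⟩ := hu
  obtain ⟨g, hg, hgw, hg0⟩ := hw
  refine ⟨fun ξ => f ξ - g ξ, hf.sub hg, ?_, by simp [hf0, hg0]⟩
  filter_upwards [hfu, hgw, Lp.coeFn_sub u.toL2 w.toL2] with ξ h₁ h₂ h₃
  rw [← h₁, ← h₂]
  exact h₃

/-! ### Coefficients of the model -/

/-- The projection of the line onto the unit interval. -/
noncomputable def unitProj (ξ : ℝ) : ℝ := projIcc (0 : ℝ) 1 zero_le_one ξ

theorem continuous_unitProj : Continuous unitProj := continuous_subtype_val.comp continuous_projIcc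

theorem unitProj_mem (ξ : ℝ) : unitProj ξ ∈ Icc (0 : ℝ) 1 := (projIcc (0 : ℝ) 1 zero_le_one ξ).2

theorem unitProj_of_mem {ξ : ℝ} (hξ : ξ ∈ Icc (0 : ℝ) 1) : unitProj ξ = ξ := by
  rw [unitProj, projIcc_of_mem _ hξ]

/-- A velocity that is continuous and positive on `[0,1]`, frozen outside of `[0,1]`, has a travel
time. -/
theorem exists_isTravelTime {V : ℝ → ℝ} (hV : ContinuousOn V (Icc 0 1))
    (hV_pos : ∀ ξ ∈ Icc (0 : ℝ) 1, 0 < V ξ) :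
    ∃ (τ : ℝ → ℝ) (m M : ℝ≥0), IsTravelTime (fun ξ => (V (unitProj ξ))⁻¹) τ m M := by
  have hc : Continuous fun ξ => V (unitProj ξ) :=
    hV.comp_continuous continuous_unitProj unitProj_mem
  have hp : ∀ ξ, 0 < V (unitProj ξ) := fun ξ => hV_pos _ (unitProj_mem ξ)
  have hWc := hc.inv₀ fun ξ => (hp ξ).ne'
  obtain ⟨x, hx, hxmin⟩ := isCompact_Icc.exists_isMinOn (nonempty_Icc.2 zero_le_one) hV
  obtain ⟨y, hy, hymax⟩ := isCompact_Icc.exists_isMaxOn (nonempty_Icc.2 zero_le_one) hV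
  refine ⟨fun ξ => ∫ y in (0 : ℝ)..ξ, (V (unitProj y))⁻¹, ⟨(V y)⁻¹, (inv_pos.2 (hV_pos y hy)).le⟩,
    ⟨(V x)⁻¹, (inv_pos.2 (hV_pos x hx)).le⟩, hWc, ?_, fun ξ => ?_, fun ξ => ?_,
    fun ξ => (hWc.integral_hasStrictDerivAt 0 ξ).hasDerivAt, by simp⟩
  · exact NNReal.coe_pos.1 (inv_pos.2 (hV_pos y hy))
  · exact inv_anti₀ (hp ξ) (hymax (unitProj_mem ξ))
  · exact inv_anti₀ (hV_pos x hx) (hxmin (unitProj_mem ξ))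

/-- A continuously differentiable function on `[0,T]` extends to the line. -/
theorem exists_C1_extension {v : ℝ → ℝ} {T : ℝ} (hT : 0 < T) (hv : ContDiffOn ℝ 1 v (Icc 0 T)) :
    ∃ w w' : ℝ → ℝ, Continuous w' ∧ (∀ t, HasDerivAt w (w' t) t) ∧ EqOn w v (Icc 0 T) := by
  have hd : ContinuousOn (derivWithin v (Icc 0 T)) (Icc 0 T) :=
    hv.continuousOn_derivWithin (uniqueDiffOn_Icc hT) le_rfl
  have hc : Continuous (IccExtend hT.le ((Icc 0 T).domRestrict (derivWithin v (Icc 0 T)))) :=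
    (continuousOn_iff_continuous_domRestrict.1 hd).Icc_extend'
  refine ⟨fun t => v 0 + ∫ s in (0 : ℝ)..t,
      IccExtend hT.le ((Icc 0 T).domRestrict (derivWithin v (Icc 0 T))) s, _, hc,
    fun t => ((hc.integral_hasStrictDerivAt 0 t).hasDerivAt).const_add _, fun t ht => ?_⟩
  have e : ∫ s in (0 : ℝ)..t, IccExtend hT.le ((Icc 0 T).domRestrict (derivWithin v (Icc 0 T))) s =
      v t - v 0 := by
    refine intervalIntegral.integral_eq_sub_of_hasDerivAt_of_le ht.1
      (hv.continuousOn.mono (Icc_subset_Icc_right ht.2)) (fun s hs => ?_)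
      (hc.intervalIntegrable _ _)
    have hs' : s ∈ Ioo 0 T := ⟨hs.1, hs.2.trans_le ht.2⟩
    rw [IccExtend_of_mem _ _ (Ioo_subset_Icc_self hs')]
    exact (hv.differentiableOn one_ne_zero s
      (Ioo_subset_Icc_self hs')).hasDerivWithinAt.hasDerivAt (Icc_mem_nhds hs'.1 hs'.2)
  simp only [e, add_sub_cancel]

/-- Coefficients `N(v(t),ξ)` of the model, frozen outside of `[0,1]` in `ξ`. -/
theorem exists_isC1Time {N : ℝ → ℝ → ℝ}
    (hN : ContDiffOn ℝ 1 (fun p : ℝ × ℝ => N p.1 p.2) (univ ×ˢ Icc 0 1)) {w w' : ℝ → ℝ}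
    (hw' : Continuous w') (hw : ∀ t, HasDerivAt w (w' t) t) :
    ∃ kt, IsC1Time (fun ξ t => N (w t) (unitProj ξ)) kt := by
  have hwc : Continuous w := continuous_iff_continuousAt.2 fun t => (hw t).continuousAt
  set S : Set (ℝ × ℝ) := univ ×ˢ Icc (0 : ℝ) 1 with hS
  have hu : UniqueDiffOn ℝ S := uniqueDiffOn_univ.prod (uniqueDiffOn_Icc zero_lt_one)
  have hp : Continuous fun p : ℝ × ℝ => (w p.2, unitProj p.1) :=
    (hwc.comp continuous_snd).prodMk (continuous_unitProj.comp continuous_fst)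
  have hmem : ∀ ξ t, (w t, unitProj ξ) ∈ S := fun ξ t => ⟨mem_univ _, unitProj_mem ξ⟩
  refine ⟨fun ξ t => fderivWithin ℝ (fun p : ℝ × ℝ => N p.1 p.2) S (w t, unitProj ξ) (w' t, 0),
    ?_, ?_, fun ξ t => ?_⟩
  · exact hN.continuousOn.comp_continuous hp fun p => hmem p.1 p.2
  · exact ((hN.continuousOn_fderivWithin hu le_rfl).comp_continuous hp
      fun p => hmem p.1 p.2).clm_apply ((hw'.comp continuous_snd).prodMk continuous_const)
  · have h1 := (hN.differentiableOn one_ne_zero _ (hmem ξ t)).hasFDerivWithinAt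
    have h2 : HasDerivAt (fun s => (w s, unitProj ξ)) (w' t, 0) t :=
      (hw t).prodMk (hasDerivAt_const t _)
    exact HasFDerivWithinAt.comp_hasDerivAt (l := fun p : ℝ × ℝ => N p.1 p.2) t h1 h2
      (Eventually.of_forall fun s => hmem ξ s)

end FrBD

theorem mainTheorem5
    (absReg : ℝ → ℝ → ℝ) (h_abs : FrBD.IsAbsRegularization absReg)
    (V : ℝ → ℝ) (hV : ContDiffOn ℝ 1 V (Icc 0 1)) (hV_pos : ∀ ξ ∈ Icc (0 : ℝ) 1, 0 < V ξ)
    (σ₀ : ℝ → ℝ → ℝ)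
    (hσ₀ : ContDiffOn ℝ 1 (fun p : ℝ × ℝ => σ₀ p.1 p.2) (univ ×ˢ Icc 0 1))
    (hσ₀_nonneg : ∀ x, ∀ ξ ∈ Icc (0 : ℝ) 1, 0 ≤ σ₀ x ξ)
    (σ₁ : ℝ → ℝ → ℝ)
    (hσ₁ : ContDiffOn ℝ 1 (fun p : ℝ × ℝ => σ₁ p.1 p.2) (univ ×ˢ Icc 0 1))
    (hσ₁_nonneg : ∀ x, ∀ ξ ∈ Icc (0 : ℝ) 1, 0 ≤ σ₁ x ξ)
    (μ : ℝ → ℝ) (hμ : ContDiff ℝ 1 μ)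
    (μmin : ℝ) (hμmin : 0 < μmin) (hμ_ge : ∀ x, μmin ≤ μ x)
    (ε : ℝ) (hε : 0 < ε) (T : ℝ) (hT : 0 < T)
    (v : ℝ → ℝ) (hv : ContDiffOn ℝ 1 v (Icc 0 T))
    (z₀ : FrBD.H1) (hz₀ : z₀.VanishesAtZero) :
    ∃ z : ℝ → FrBD.H1,
      FrBD.IsClassicalSolution (absReg ε) V σ₀ σ₁ μ T v z₀ z ∧
      ∀ y : ℝ → FrBD.H1, FrBD.IsClassicalSolution (absReg ε) V σ₀ σ₁ μ T v z₀ y →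
        EqOn y z (Icc 0 T) := by
  have habs := h_abs.contDiff ε hε
  have habs0 := h_abs.nonneg ε hε.le
  have hg_pos : ∀ x, ∀ ξ ∈ Icc (0 : ℝ) 1, 0 < FrBD.g (absReg ε) σ₁ μ x ξ := fun x ξ hξ =>
    add_pos_of_nonneg_of_pos (mul_nonneg (hσ₁_nonneg x ξ hξ) (habs0 x))
      (hμmin.trans_le (hμ_ge x))
  have hg : ContDiffOn ℝ 1 (fun p : ℝ × ℝ => FrBD.g (absReg ε) σ₁ μ p.1 p.2) (univ ×ˢ Icc 0 1) :=
    (hσ₁.mul (habs.comp contDiff_fst).contDiffOn).add (hμ.comp contDiff_fst).contDiffOn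
  have hg0 : ∀ p ∈ (univ ×ˢ Icc 0 1 : Set (ℝ × ℝ)), FrBD.g (absReg ε) σ₁ μ p.1 p.2 ≠ 0 :=
    fun p hp => (hg_pos p.1 p.2 hp.2).ne'
  obtain ⟨w, w', hw', hw, hwv⟩ := FrBD.exists_C1_extension hT hv
  obtain ⟨αt, hα⟩ := FrBD.exists_isC1Time
    (N := fun x ξ => σ₀ x ξ * absReg ε x / FrBD.g (absReg ε) σ₁ μ x ξ)
    ((hσ₀.mul (habs.comp contDiff_fst).contDiffOn).div hg hg0) hw' hw
  obtain ⟨βt, hβ⟩ := FrBD.exists_isC1Time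
    (N := fun x ξ => μ x / FrBD.g (absReg ε) σ₁ μ x ξ * x)
    (((hμ.comp contDiff_fst).contDiffOn.div hg hg0).mul contDiff_fst.contDiffOn) hw' hw
  obtain ⟨τ, m, M, hτ⟩ := FrBD.exists_isTravelTime hV.continuousOn hV_pos
  obtain ⟨z, Z', hz, hZ', hd, hpde, hbd, hz0⟩ :=
    FrBD.exists_transport_solution hτ hα hβ z₀ hz₀
  have hsol : FrBD.IsClassicalSolution (absReg ε) V σ₀ σ₁ μ T v z₀ z := by
    refine ⟨?_, hz.continuousOn, fun t ht => ?_, fun t ht => hbd t ht.1.le, hz0⟩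
    · refine (contDiff_one_iff_deriv.2 ⟨fun t => (hd t).differentiableAt, ?_⟩).contDiffOn
      rwa [show deriv (fun t => (z t).toL2) = Z' from funext fun t => (hd t).deriv]
    · filter_upwards [hpde t, FrBD.ae_mem_unit] with ξ h₁ hξ
      have hξ' := Ioo_subset_Icc_self hξ
      have hV0 := (hV_pos ξ hξ').ne'
      rw [FrBD.unitProj_of_mem hξ', hwv (Ioo_subset_Icc_self ht)] at h₁
      rw [(hd t).deriv]
      have h₂ := congrArg (V ξ * ·) h₁
      simp only [mul_add, ← mul_assoc, mul_inv_cancel₀ hV0, one_mul] at h₂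
      linarith
  refine ⟨z, hsol, fun y hy t ht => FrBD.H1.ext_toL2 (sub_eq_zero.1 ?_)⟩
  refine FrBD.toL2_eq_zero_of_transport (d := fun t => y t - z t) (T := T) hτ.cont hτ.slowness_pos
    (a := fun ξ t => σ₀ (v t) ξ * absReg ε (v t) / FrBD.g (absReg ε) σ₁ μ (v t) ξ)
    (fun t ξ hξ => ?_) ?_ (fun t ht => ?_) (fun t ht => ?_) ?_ t ht
  · have hξ' := Ioo_subset_Icc_self hξ
    exact div_nonneg (mul_nonneg (hσ₀_nonneg _ ξ hξ') (habs0 _)) (hg_pos _ ξ hξ').le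
  · exact hy.contDiffOn_L2.continuousOn.sub hsol.contDiffOn_L2.continuousOn
  · have hyd := ((hy.contDiffOn_L2.differentiableOn one_ne_zero).differentiableAt
      (Icc_mem_nhds ht.1 ht.2)).hasDerivAt
    have hzd := ((hsol.contDiffOn_L2.differentiableOn one_ne_zero).differentiableAt
      (Icc_mem_nhds ht.1 ht.2)).hasDerivAt
    refine ⟨_, hyd.sub hzd, ?_⟩
    filter_upwards [hy.pde t ht, hsol.pde t ht, FrBD.ae_mem_unit,
      Lp.coeFn_sub (deriv (fun s => (y s).toL2) t) (deriv (fun s => (z s).toL2) t),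
      Lp.coeFn_sub (y t).toL2 (z t).toL2, Lp.coeFn_sub (y t).weakDeriv (z t).weakDeriv]
      with ξ h₁ h₂ hξ e₁ e₂ e₃
    have hξ' := Ioo_subset_Icc_self hξ
    have hV0 := (hV_pos ξ hξ').ne'
    change (y t - z t).toL2 ξ = (y t).toL2 ξ - (z t).toL2 ξ at e₂
    change (y t - z t).weakDeriv ξ = (y t).weakDeriv ξ - (z t).weakDeriv ξ at e₃
    rw [FrBD.unitProj_of_mem hξ', e₁, e₂, e₃, Pi.sub_apply]
    linear_combination (V ξ)⁻¹ * (h₁ - h₂) -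
      ((y t).weakDeriv ξ - (z t).weakDeriv ξ) * inv_mul_cancel₀ hV0
  · exact (hy.boundary t ht).sub (hsol.boundary t ht)
  · rw [hy.initial, hsol.initial, sub_self]
    rfl
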